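/- Let $\lambda>0$ and $\mu\ge 0$, and consider the Hadamard elastic material whose stored energy function is $\widehat w(\delta,\eta)=\mathcal W(\eta^{1/3},\delta/\eta)$, $\delta,\eta>0$, with \[ \mathcal W(x,y)=x^{-4}\Big((\lambda+\mu)y^{-2}+\tfrac12(\lambda+\mu)\Big)-(\lambda+2\mu)x^{-3}y^{-1}+x^{-2}\Big(-\tfrac12\lambda y^{-2}-\lambda\Big)+\tfrac12(2\lambda+\mu), \] so that its constitutive functions on $(0,\infty)^2$ are \[ \widehat p_{\rm rad}=\delta^2\,\partial_\delta\widehat w,\qquad \widehat p_{\rm tan}=\widehat p_{\rm rad}+\tfrac32\,\delta\eta\,\partial_\eta\widehat w . \] Given functions $\rho,p_{\rm rad},p_{\rm tan}:[0,\infty)\to\mathbb R$, put $m(r)=4\pi\int_0^r\rho(s)s^2\,ds$. The triple $(\rho,p_{\rm rad},p_{\rm tan})$ is a regular static self-gravitating ball of radius $R>0$ if $\mathrm{Int}\{r>0:\rho(r)>0\}=(0,R)$ and: (i) the three functions belong to $C^0([0,R])\cap C^1((0,R])$ and satisfy \[ p_{\rm rad}'(r)=-\frac2r\,(p_{\rm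 rad}-p_{\rm tan})-\rho\,\frac{m}{r^2},\qquad r\in(0,R); \] (ii) $p_{\rm rad},p_{\rm tan}>0$ on $[0,R)$; (iii) $p_{\rm rad}(R)=0$; (iv) $p_{\rm rad}(0)=p_{\rm tan}(0)$; (v) $\rho=p_{\rm rad}=p_{\rm tan}=0$ on $(R,\infty)$. It is strongly regular if moreover the three functions belong to $C^1([0,R])$ and their derivatives tend to $0$ as $r\to0^+$. It is a ball of the Hadamard material with reference density $\mathcal K>0$ if $p_{\rm rad}(r)=\widehat p_{\rm rad}(\delta(r),\eta(r))$ and $p_{\rm tan}(r)=\widehat p_{\rm tan}(\delta(r),\eta(r))$ for all $r>0$ with $\rho(r)>0$, where $\delta(r)=\rho(r)/\mathcal K$ and $\eta(r)=m(r)/(\frac{4\pi}{3}\mathcal K r^3)$. Then: (a) Every regular static self-gravitating ball of the Hadamard material with reference density $\mathcal K$ satisfies $\rho(0)/\mathcal K>1$. (b) Let $\mathcal K>0$ and let $\rho_c$ be such that $\delta_c:=\rho_c/\mathcal K$ satisfies \[ 1<\delta_c<\Delta_\sharp:=\Big(\frac{\lambda+\mu}{\lambda}\Big)^{3/2}. \]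 Then $\partial_\delta\widehat p_{\rm rad}(\delta_c,\delta_c)>0$, and there is exactly one regular static self-gravitating ball of the Hadamard material with reference density $\mathcal K$ and central density $\rho(0)=\rho_c$; this ball is strongly regular (in particular, it is the unique strongly regular one). Moreover, if $R$ is its radius, then for all $r\in(0,R]$ one has $\rho(r)>0$ and \[ \partial_\delta\widehat p_{\rm rad}(\delta(r),\eta(r))>0,\qquad \rho(r)<\rho_c,\qquad \frac{4\pi}{3}\max(\rho(r),\mathcal K)\,r^3<m(r)<\frac{4\pi}{3}\rho_c\,r^3 . \] -/

import Mathlib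

open Set Filter Topology

noncomputable section

/-- The mass `m(r) = 4π ∫₀ʳ ρ(s) s² ds` enclosed in the ball of radius `r`. -/
def enclosedMass (ρ : ℝ → ℝ) (r : ℝ) : ℝ :=
  4 * Real.pi * ∫ s in (0 : ℝ)..r, ρ s * s ^ 2

/-- `(ρ, prad, ptan)` is a regular static self-gravitating ball of matter of radius `R`.
Only the values of the three functions on `[0, ∞)` matter. Regularity at the boundary point `R`
is one-sided, since the profiles may jump to `0` there. -/
structure IsRegularBall (ρ prad ptan : ℝ → ℝ) (R : ℝ) : Prop where
  radius_pos : 0 < R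
  support : interior {r : ℝ | 0 < r ∧ 0 < ρ r} = Ioo 0 R
  cont_rho : ContinuousOn ρ (Icc 0 R)
  cont_prad : ContinuousOn prad (Icc 0 R)
  cont_ptan : ContinuousOn ptan (Icc 0 R)
  contDiff_rho : ContDiffOn ℝ 1 ρ (Ioc 0 R)
  contDiff_prad : ContDiffOn ℝ 1 prad (Ioc 0 R)
  contDiff_ptan : ContDiffOn ℝ 1 ptan (Ioc 0 R)
  /-- Hydrostatic equilibrium `prad' = -(2/r)(prad - ptan) - ρ Φ'`, where the Newtonian potential
  satisfies `Φ' = m / r²`. -/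
  equilibrium : ∀ r ∈ Ioo 0 R,
    HasDerivAt prad (-(2 / r) * (prad r - ptan r) - ρ r * (enclosedMass ρ r / r ^ 2)) r
  prad_pos : ∀ r ∈ Ico 0 R, 0 < prad r
  ptan_pos : ∀ r ∈ Ico 0 R, 0 < ptan r
  prad_boundary : prad R = 0
  isotropic_center : prad 0 = ptan 0
  rho_vacuum : ∀ r, R < r → ρ r = 0
  prad_vacuum : ∀ r, R < r → prad r = 0
  ptan_vacuum : ∀ r, R < r → ptan r = 0

/-- A regular ball is strongly regular if the profiles are `C¹` up to the center and their
derivatives vanish there. -/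
structure IsStronglyRegularBall (ρ prad ptan : ℝ → ℝ) (R : ℝ) : Prop
    extends IsRegularBall ρ prad ptan R where
  contDiff_rho_center : ContDiffOn ℝ 1 ρ (Icc 0 R)
  contDiff_prad_center : ContDiffOn ℝ 1 prad (Icc 0 R)
  contDiff_ptan_center : ContDiffOn ℝ 1 ptan (Icc 0 R)
  deriv_rho_center : Tendsto (deriv ρ) (𝓝[>] 0) (𝓝 0)
  deriv_prad_center : Tendsto (deriv prad) (𝓝[>] 0) (𝓝 0)
  deriv_ptan_center : Tendsto (deriv ptan) (𝓝[>] 0) (𝓝 0)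

/-- The compression `δ(r) = ρ(r) / K` relative to the reference density `K`. -/
def relDensity (K : ℝ) (ρ : ℝ → ℝ) (r : ℝ) : ℝ := ρ r / K

/-- The mean compression `η(r) = m(r) / ((4π/3) K r³)`. -/
def meanRelDensity (K : ℝ) (ρ : ℝ → ℝ) (r : ℝ) : ℝ :=
  enclosedMass ρ r / (4 * Real.pi / 3 * K * r ^ 3)

/-- The pressures are given by `C¹` constitutive functions `phrad, phtan` on `(0, ∞)²` with
reference density `K`, wherever there is matter. -/
structure HasElasticPressures (K : ℝ) (phrad phtan : ℝ → ℝ → ℝ) (ρ prad ptan : ℝ → ℝ) : Prop where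
  refDensity_pos : 0 < K
  contDiff_rad : ContDiffOn ℝ 1 (fun q : ℝ × ℝ => phrad q.1 q.2) (Ioi 0 ×ˢ Ioi 0)
  contDiff_tan : ContDiffOn ℝ 1 (fun q : ℝ × ℝ => phtan q.1 q.2) (Ioi 0 ×ˢ Ioi 0)
  rad_eq : ∀ r, 0 < r → 0 < ρ r → prad r = phrad (relDensity K ρ r) (meanRelDensity K ρ r)
  tan_eq : ∀ r, 0 < r → 0 < ρ r → ptan r = phtan (relDensity K ρ r) (meanRelDensity K ρ r)

/-- Regular static self-gravitating elastic ball of radius `R` with reference density `K` and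
constitutive functions `phrad, phtan`. -/
def IsRegularElasticBall (K : ℝ) (phrad phtan : ℝ → ℝ → ℝ)
    (ρ prad ptan : ℝ → ℝ) (R : ℝ) : Prop :=
  IsRegularBall ρ prad ptan R ∧ HasElasticPressures K phrad phtan ρ prad ptan

/-- Strongly regular static self-gravitating elastic ball. -/
def IsStronglyRegularElasticBall (K : ℝ) (phrad phtan : ℝ → ℝ → ℝ)
    (ρ prad ptan : ℝ → ℝ) (R : ℝ) : Prop :=
  IsStronglyRegularBall ρ prad ptan R ∧ HasElasticPressures K phrad phtan ρ prad ptan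

/-- Radial constitutive function of a hyperelastic material: `δ² ∂_δ w`. -/
def hyperelasticRad (w : ℝ → ℝ → ℝ) (δ η : ℝ) : ℝ :=
  δ ^ 2 * deriv (fun d => w d η) δ

/-- Tangential constitutive function of a hyperelastic material: `prad + (3/2) δ η ∂_η w`. -/
def hyperelasticTan (w : ℝ → ℝ → ℝ) (δ η : ℝ) : ℝ :=
  hyperelasticRad w δ η + 3 / 2 * δ * η * deriv (fun e => w δ e) η

/-- Hadamard stored energy (case `k = 1/2`) in the variables `x = η^(1/3)`, `y = δ / η`. -/
def hadamardW (lam mu x y : ℝ) : ℝ :=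
  (x ^ 4)⁻¹ * ((lam + mu) * (y ^ 2)⁻¹ + 1 / 2 * (lam + mu))
    - (lam + 2 * mu) * (x ^ 3)⁻¹ * y⁻¹
    + (x ^ 2)⁻¹ * (-(1 / 2) * lam * (y ^ 2)⁻¹ - lam)
    + 1 / 2 * (2 * lam + mu)

/-- Hadamard stored energy as a function of `(δ, η)`. -/
def hadamardEnergy (lam mu δ η : ℝ) : ℝ :=
  hadamardW lam mu (η ^ (1 / 3 : ℝ)) (δ / η)

/-- Radial constitutive function of the Hadamard material. -/
def hadamardRad (lam mu : ℝ) : ℝ → ℝ → ℝ := hyperelasticRad (hadamardEnergy lam mu)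

/-- Tangential constitutive function of the Hadamard material. -/
def hadamardTan (lam mu : ℝ) : ℝ → ℝ → ℝ := hyperelasticTan (hadamardEnergy lam mu)

end

/-!
In closed form `p_rad = λ + 2μ - h(η) / δ` and `p_tan - p_rad = g(η) (1 / δ - δ / η²)`, with `g`
and `h` positive for `η < Δ_♯`, so the equilibrium equation can be solved for `δ'` and becomes,
together with `η' = 3 (δ - η) / r`, a system that is singular at `r = 0`. It is regularized by
`v = (δ - η) / r²`, which satisfies `r v' = -5 v - f` with `f` Lipschitz: a contraction argument
gives existence, and since the singular term damps the difference of two solutions, an energy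
estimate gives uniqueness. Along a solution `v < 0`, hence `δ < η < δ_c`; the density decreases at a
rate bounded below, so the radial pressure reaches zero, and its first zero is the radius. The
radial pressure at the center is positive exactly when `δ_c > 1`.
-/

noncomputable section

section RealAnalysis

lemma tendsto_nhdsGT_of_continuousOn {f : ℝ → ℝ} {R : ℝ} (hR : 0 < R)
    (hf : ContinuousOn f (Icc 0 R)) : Tendsto f (𝓝[>] 0) (𝓝 (f 0)) := by
  rw [← nhdsWithin_Ioo_eq_nhdsGT hR]
  exact (hf 0 ⟨le_rfl, hR.le⟩).mono_left (nhdsWithin_mono _ Ioo_subset_Icc_self)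

lemma exists_first_eq_of_continuousOn {f : ℝ → ℝ} {a b c : ℝ} (hab : a ≤ b)
    (hf : ContinuousOn f (Icc a b)) (ha : f a < c) (hb : c ≤ f b) :
    ∃ x ∈ Ioc a b, f x = c ∧ ∀ y ∈ Ico a x, f y < c := by
  have hcompact : IsCompact (Icc a b ∩ f ⁻¹' Ici c) := isCompact_Icc.of_isClosed_subset
    (hf.preimage_isClosed_of_isClosed isClosed_Icc isClosed_Ici) inter_subset_left
  obtain ⟨x, ⟨hx, hcx⟩, hleast⟩ := hcompact.exists_isLeast ⟨b, ⟨hab, le_rfl⟩, hb⟩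
  have hlt : ∀ y ∈ Ico a x, f y < c := fun y hy => by
    by_contra! hcy
    exact hy.2.not_ge (hleast ⟨⟨hy.1, hy.2.le.trans hx.2⟩, hcy⟩)
  obtain ⟨z, hz, hfz⟩ := intermediate_value_Icc hx.1 (hf.mono (Icc_subset_Icc_right hx.2))
    ⟨ha.le, hcx⟩
  obtain rfl : z = x := by
    by_contra hne
    exact (hlt z ⟨hz.1, hz.2.lt_of_ne hne⟩).ne hfz
  exact ⟨z, ⟨hx.1.lt_of_ne fun h => ha.ne (h ▸ hfz), hx.2⟩, hfz, hlt⟩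

lemma contDiffOn_one_of_hasDerivAt {f f' : ℝ → ℝ} {R : ℝ} (hR : 0 < R)
    (hf : ∀ r ∈ Icc 0 R, HasDerivAt f (f' r) r) (hf' : ContinuousOn f' (Icc 0 R)) :
    ContDiffOn ℝ 1 f (Icc 0 R) := by
  have hu := uniqueDiffOn_Icc hR
  rw [contDiffOn_one_iff_derivWithin hu]
  exact ⟨fun r hr => (hf r hr).differentiableAt.differentiableWithinAt,
    hf'.congr fun r hr => (hf r hr).hasDerivWithinAt.derivWithin (hu r hr)⟩

lemma nonpos_of_deriv_le_mul {R C : ℝ} {Q Q' : ℝ → ℝ} (hQ : ∀ r ∈ Ioo 0 R, HasDerivAt Q (Q' r) r)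
    (hle : ∀ r ∈ Ioo 0 R, Q' r ≤ C * Q r) (h0 : Tendsto Q (𝓝[>] 0) (𝓝 0)) :
    ∀ r ∈ Ioo 0 R, Q r ≤ 0 := by
  set W : ℝ → ℝ := fun r => Q r * Real.exp (-C * r)
  have hW (r) (hr : r ∈ Ioo 0 R) : HasDerivAt W ((Q' r - C * Q r) * Real.exp (-C * r)) r := by
    refine ((hQ r hr).mul ((hasDerivAt_id r).const_mul (-C)).exp).congr_deriv ?_
    simp only [id]
    ring
  have hanti : AntitoneOn W (Ioo 0 R) := by
    refine antitoneOn_of_hasDerivWithinAt_nonpos (convex_Ioo 0 R)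
      (f' := fun r => (Q' r - C * Q r) * Real.exp (-C * r))
      (fun r hr => (hW r hr).continuousAt.continuousWithinAt) ?_ ?_ <;> rw [interior_Ioo]
    · exact fun r hr => (hW r hr).hasDerivWithinAt
    · exact fun r hr => mul_nonpos_of_nonpos_of_nonneg (sub_nonpos.2 (hle r hr)) (Real.exp_pos _).le
  have hW0 : Tendsto W (𝓝[>] 0) (𝓝 0) := by
    have hexp : Continuous fun r : ℝ => Real.exp (-C * r) := by fun_prop
    simpa only [zero_mul] using h0.mul ((hexp.tendsto 0).mono_left nhdsWithin_le_nhds)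
  intro r hr
  have : W r ≤ 0 := by
    refine ge_of_tendsto hW0 ?_
    filter_upwards [Ioo_mem_nhdsGT hr.1] with s hs
    exact hanti ⟨hs.1, hs.2.trans hr.2⟩ hr hs.2.le
  exact nonpos_of_mul_nonpos_left this (Real.exp_pos _)

lemma locallyLipschitzOn_of_contDiffAt {E : Type*} [NormedAddCommGroup E] [NormedSpace ℝ E]
    {s : Set E} {f : E → ℝ} (hf : ∀ x ∈ s, ContDiffAt ℝ 1 f x) : LocallyLipschitzOn s f := by
  intro x hx
  obtain ⟨L, t, ht, hL⟩ := (hf x hx).exists_lipschitzOnWith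
  exact ⟨L, t, mem_nhdsWithin_of_mem_nhds ht, hL⟩

lemma exists_lipschitz_extension {α : Type*} [PseudoMetricSpace α] {s : Set α} {f : α → ℝ}
    {a b : ℝ} (hs : IsCompact s) (hf : LocallyLipschitzOn s f) (hab : a ≤ b)
    (hmem : MapsTo f s (Icc a b)) :
    ∃ (L : NNReal) (g : α → ℝ), LipschitzWith L g ∧ (∀ x, g x ∈ Icc a b) ∧ EqOn g f s := by
  obtain ⟨L, hL⟩ := hf.exists_lipschitzOnWith_of_compact hs
  obtain ⟨g, hg, hgf⟩ := hL.extend_real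
  refine ⟨L, fun x => max a (min (g x) b), (hg.min_const b).const_max a,
    fun x => ⟨le_max_left _ _, max_le hab (min_le_right _ _)⟩, fun x hx => ?_⟩
  have hfx := hmem hx
  simp only [← hgf hx, min_eq_left hfx.2, max_eq_right hfx.1]

end RealAnalysis

section SingularIVP

variable {E : Type*} [NormedAddCommGroup E] [NormedSpace ℝ E] {T N L k r s D : ℝ} {n : ℕ}

lemma integral_exp_mul_le (hN : 0 < N) :
    ∫ t in (0 : ℝ)..s, Real.exp (N * t) ≤ Real.exp (N * s) / N := by
  rw [intervalIntegral.integral_comp_mul_left _ hN.ne', integral_exp, mul_zero, Real.exp_zero,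
    smul_eq_mul, inv_mul_eq_div]
  gcongr
  linarith

/-- The extension `r ↦ exp (N r) w(r)` to the line of a function on `[0, T]`. Representing the
unknown this way turns the sup distance of `C([0, T])` into an exponentially weighted one. -/
def weightedExtend (hT : 0 ≤ T) (N : ℝ) (w : C(Icc (0 : ℝ) T, E)) (r : ℝ) : E :=
  Real.exp (N * r) • w (projIcc 0 T hT r)

lemma continuous_weightedExtend (hT : 0 ≤ T) (N : ℝ) (w : C(Icc (0 : ℝ) T, E)) :
    Continuous (weightedExtend hT N w) :=
  (by fun_prop : Continuous fun r : ℝ => Real.exp (N * r)).smul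
    (w.continuous.comp continuous_projIcc)

lemma norm_weightedExtend_sub_le (hT : 0 ≤ T) (N : ℝ) (w w' : C(Icc (0 : ℝ) T, E)) (r : ℝ) :
    ‖weightedExtend hT N w r - weightedExtend hT N w' r‖ ≤ Real.exp (N * r) * dist w w' := by
  rw [weightedExtend, weightedExtend, ← smul_sub, norm_smul, Real.norm_eq_abs, Real.abs_exp,
    ← dist_eq_norm]
  gcongr
  exact ContinuousMap.dist_apply_le_dist _

/-- The integral `∫₀ˢ t u(t) dt`. -/
def firstMoment (u : ℝ → E) (s : ℝ) : E := ∫ t in (0 : ℝ)..s, t • u t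

lemma hasDerivAt_firstMoment [CompleteSpace E] {u : ℝ → E} (hu : Continuous u) (s : ℝ) :
    HasDerivAt (firstMoment u) (s • u s) s :=
  (continuous_id.smul hu).integral_hasStrictDerivAt 0 s |>.hasDerivAt

lemma continuous_firstMoment {u : ℝ → E} (hu : Continuous u) : Continuous (firstMoment u) :=
  intervalIntegral.continuous_primitive
    (fun _ _ => (continuous_id.smul hu).intervalIntegrable _ _) 0

lemma norm_firstMoment_sub_le (hN : 0 < N) (hs : s ∈ Icc 0 T) {u u' : ℝ → E}
    (hu : Continuous u) (hu' : Continuous u') (hD : 0 ≤ D)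
    (h : ∀ t, ‖u t - u' t‖ ≤ Real.exp (N * t) * D) :
    ‖firstMoment u s - firstMoment u' s‖ ≤ T / N * Real.exp (N * s) * D := by
  have hT : 0 ≤ T := hs.1.trans hs.2
  have hpt (t : ℝ) (ht : t ∈ Ioc 0 s) : ‖t • u t - t • u' t‖ ≤ T * D * Real.exp (N * t) := by
    rw [← smul_sub, norm_smul, Real.norm_of_nonneg ht.1.le, mul_assoc, mul_comm D]
    exact mul_le_mul (ht.2.trans hs.2) (h t) (norm_nonneg _) hT
  rw [firstMoment, firstMoment, ← intervalIntegral.integral_sub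
    (Continuous.intervalIntegrable (by fun_prop) _ _)
    (Continuous.intervalIntegrable (by fun_prop) _ _)]
  calc ‖∫ t in (0 : ℝ)..s, (t • u t - t • u' t)‖
      ≤ ∫ t in (0 : ℝ)..s, T * D * Real.exp (N * t) :=
        intervalIntegral.norm_integral_le_of_norm_le hs.1 (Eventually.of_forall hpt)
          (Continuous.intervalIntegrable (by fun_prop) _ _)
    _ ≤ T * D * (Real.exp (N * s) / N) := by
        rw [intervalIntegral.integral_const_mul]
        gcongr
        exact integral_exp_mul_le hN
    _ = T / N * Real.exp (N * s) * D := by ring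

/-- The average `∫₀¹ τⁿ g(r τ) dτ`, which for `r ≠ 0` is `r⁻ⁿ⁻¹ ∫₀ʳ sⁿ g(s) ds`. -/
def powerMean (n : ℕ) (g : ℝ → E) (r : ℝ) : E := ∫ τ in (0 : ℝ)..1, τ ^ n • g (r * τ)

lemma continuous_powerMean (n : ℕ) {g : ℝ → E} (hg : Continuous g) :
    Continuous (powerMean n g) := by
  refine intervalIntegral.continuous_parametric_intervalIntegral_of_continuous' ?_ 0 1
  simp only [Function.uncurry_def]
  fun_prop

lemma pow_succ_smul_powerMean (n : ℕ) (g : ℝ → E) (r : ℝ) :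
    r ^ (n + 1) • powerMean n g r = ∫ s in (0 : ℝ)..r, s ^ n • g s := by
  have h := intervalIntegral.smul_integral_comp_mul_left (a := 0) (b := 1)
    (f := fun s => s ^ n • g s) r
  simp only [mul_zero, mul_one, mul_pow, mul_smul, intervalIntegral.integral_smul] at h
  rw [← h, powerMean, pow_succ', mul_smul]

lemma norm_powerMean_sub_le (hN : 0 < N) (hL : 0 ≤ L) (hk : 0 ≤ k) (hD : 0 ≤ D) (hr : 0 ≤ r)
    {g g' : ℝ → E} (hg : Continuous g) (hg' : Continuous g')
    (h : ∀ s ∈ Icc 0 r, ‖g s - g' s‖ ≤ (k + L * s) * Real.exp (N * s) * D) :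
    ‖powerMean n g r - powerMean n g' r‖ ≤ Real.exp (N * r) * ((k / (n + 1) + L / N) * D) := by
  have hpt (τ : ℝ) (hτ : τ ∈ Ioc 0 1) : ‖τ ^ n • g (r * τ) - τ ^ n • g' (r * τ)‖ ≤
      k * Real.exp (N * r) * D * τ ^ n + L * D * (r * Real.exp (N * (r * τ))) := by
    have hτ0 : 0 ≤ τ := hτ.1.le
    have hτr : r * τ ≤ r := mul_le_of_le_one_right hr hτ.2
    have hτn : τ ^ n * τ ≤ 1 := mul_le_one₀ (pow_le_one₀ hτ0 hτ.2) hτ0 hτ.2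
    rw [← smul_sub, norm_smul, Real.norm_of_nonneg (pow_nonneg hτ0 n)]
    calc τ ^ n * ‖g (r * τ) - g' (r * τ)‖
        ≤ τ ^ n * ((k + L * (r * τ)) * Real.exp (N * (r * τ)) * D) := by
          gcongr
          exact h _ ⟨by positivity, hτr⟩
      _ = k * Real.exp (N * (r * τ)) * D * τ ^ n
          + L * D * (r * Real.exp (N * (r * τ))) * (τ ^ n * τ) := by ring
      _ ≤ _ := add_le_add (by gcongr) (mul_le_of_le_one_right (by positivity) hτn)
  have hexp : ∫ τ in (0 : ℝ)..1, r * Real.exp (N * (r * τ)) ≤ Real.exp (N * r) / N := by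
    rw [intervalIntegral.integral_const_mul, intervalIntegral.mul_integral_comp_mul_left
      (f := fun s => Real.exp (N * s)), mul_zero, mul_one]
    exact integral_exp_mul_le hN
  rw [powerMean, powerMean, ← intervalIntegral.integral_sub
    (Continuous.intervalIntegrable (by fun_prop) _ _)
    (Continuous.intervalIntegrable (by fun_prop) _ _)]
  refine (intervalIntegral.norm_integral_le_of_norm_le zero_le_one (Eventually.of_forall hpt)
    (Continuous.intervalIntegrable (by fun_prop) _ _)).trans ?_
  rw [intervalIntegral.integral_add (Continuous.intervalIntegrable (by fun_prop) _ _)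
    (Continuous.intervalIntegrable (by fun_prop) _ _), intervalIntegral.integral_const_mul,
    intervalIntegral.integral_const_mul (L * D), integral_pow, one_pow, zero_pow n.succ_ne_zero]
  calc _ ≤ k * Real.exp (N * r) * D * ((1 - 0) / (n + 1)) + L * D * (Real.exp (N * r) / N) := by
        gcongr
    _ = _ := by ring

/-- The source term `f(s, ∫₀ˢ t u(t) dt, u(s))` along the profile `u`. -/
def sourceAlong (f : ℝ → E → E → E) (u : ℝ → E) (s : ℝ) : E := f s (firstMoment u s) (u s)

variable {f : ℝ → E → E → E}

lemma continuous_sourceAlong (hf : Continuous fun p : ℝ × E × E => f p.1 p.2.1 p.2.2)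
    {u : ℝ → E} (hu : Continuous u) : Continuous (sourceAlong f u) :=
  hf.comp (continuous_id.prodMk ((continuous_firstMoment hu).prodMk hu))

lemma norm_sourceAlong_sub_le (hN : 0 < N) (hL : 0 ≤ L) (hk : 0 ≤ k) (hD : 0 ≤ D)
    (hlip : ∀ r ∈ Icc 0 T, ∀ x x' v v' : E,
      ‖f r x v - f r x' v'‖ ≤ L * ‖x - x'‖ + (k + L * r) * ‖v - v'‖)
    {u u' : ℝ → E} (hu : Continuous u) (hu' : Continuous u')
    (h : ∀ t, ‖u t - u' t‖ ≤ Real.exp (N * t) * D) (hs : s ∈ Icc 0 T) :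
    ‖sourceAlong f u s - sourceAlong f u' s‖ ≤
      (k + L * (T / N) + L * s) * Real.exp (N * s) * D := by
  have h0 : 0 ≤ k + L * s := add_nonneg hk (mul_nonneg hL hs.1)
  calc _ ≤ L * ‖firstMoment u s - firstMoment u' s‖ + (k + L * s) * ‖u s - u' s‖ :=
        hlip s hs _ _ _ _
    _ ≤ L * (T / N * Real.exp (N * s) * D) + (k + L * s) * (Real.exp (N * s) * D) := by
        gcongr
        exacts [norm_firstMoment_sub_le hN hs hu hu' hD h, h s]
    _ = _ := by ring

/-- The operator `v ↦ -powerMean n (sourceAlong f v)`, conjugated by the weight `exp (N r)`. -/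
def singularOp (hT : 0 ≤ T) (N : ℝ) (n : ℕ)
    (hf : Continuous fun p : ℝ × E × E => f p.1 p.2.1 p.2.2) (w : C(Icc (0 : ℝ) T, E)) :
    C(Icc (0 : ℝ) T, E) where
  toFun r := -(Real.exp (-(N * r)) • powerMean n (sourceAlong f (weightedExtend hT N w)) r)
  continuous_toFun := by
    have := continuous_powerMean n (continuous_sourceAlong hf (continuous_weightedExtend hT N w))
    fun_prop

lemma dist_singularOp_le (hT : 0 ≤ T) (hN : 0 < N) (hL : 0 ≤ L) (hk : 0 ≤ k)
    (hf : Continuous fun p : ℝ × E × E => f p.1 p.2.1 p.2.2)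
    (hlip : ∀ r ∈ Icc 0 T, ∀ x x' v v' : E,
      ‖f r x v - f r x' v'‖ ≤ L * ‖x - x'‖ + (k + L * r) * ‖v - v'‖)
    (w w' : C(Icc (0 : ℝ) T, E)) :
    dist (singularOp hT N n hf w) (singularOp hT N n hf w') ≤
      ((k + L * (T / N)) / (n + 1) + L / N) * dist w w' := by
  refine (ContinuousMap.dist_le (by positivity)).2 fun ⟨r, hr⟩ => ?_
  have hu (w) : Continuous (weightedExtend (E := E) hT N w) := continuous_weightedExtend hT N w
  have hmean := norm_powerMean_sub_le (n := n) (k := k + L * (T / N)) hN hL (by positivity)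
    (dist_nonneg (x := w) (y := w')) hr.1 (continuous_sourceAlong hf (hu w))
    (continuous_sourceAlong hf (hu w')) fun s hs =>
      norm_sourceAlong_sub_le hN hL hk dist_nonneg hlip (hu w) (hu w')
        (norm_weightedExtend_sub_le hT N w w') ⟨hs.1, hs.2.trans hr.2⟩
  change dist (-(Real.exp (-(N * r)) • _)) (-(Real.exp (-(N * r)) • _)) ≤ _
  rwa [dist_neg_neg, dist_eq_norm, ← smul_sub, norm_smul, Real.norm_eq_abs, Real.abs_exp,
    Real.exp_neg, inv_mul_le_iff₀ (Real.exp_pos _)]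

/-- Existence for `r v' = -(n + 1) v - f(r, ∫₀ʳ t v dt, v)` with `v` continuous up to the singular
point `r = 0`: the condition `k < n + 1` makes the integrated equation a contraction there. -/
theorem exists_singular_ivp [CompleteSpace E] (n : ℕ) (hT : 0 ≤ T) (hL : 0 ≤ L) (hk : 0 ≤ k)
    (hkn : k < n + 1) (hf : Continuous fun p : ℝ × E × E => f p.1 p.2.1 p.2.2)
    (hlip : ∀ r ∈ Icc 0 T, ∀ x x' v v' : E,
      ‖f r x v - f r x' v'‖ ≤ L * ‖x - x'‖ + (k + L * r) * ‖v - v'‖) :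
    ∃ v : ℝ → E, Continuous v ∧ ∀ r ∈ Icc 0 T,
      r ^ (n + 1) • v r = -∫ s in (0 : ℝ)..r, s ^ n • sourceAlong f v s := by
  obtain ⟨N, hq, hN⟩ : ∃ N : ℝ, (k + L * (T / N)) / (n + 1) + L / N < 1 ∧ 0 < N := by
    have hlim : Tendsto (fun N : ℝ => (k + L * (T / N)) / (n + 1) + L / N) atTop
        (𝓝 ((k + L * 0) / (n + 1) + 0)) :=
      ((((tendsto_const_nhds.div_atTop tendsto_id).const_mul L).const_add k).div_const _).add
        (tendsto_const_nhds.div_atTop tendsto_id)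
    have hlt : (k + L * 0) / (n + 1) + 0 < 1 := by
      rwa [mul_zero, add_zero, add_zero, div_lt_one (by positivity)]
    exact ((hlim.eventually_lt_const hlt).and (eventually_gt_atTop 0)).exists
  let q : NNReal := ⟨(k + L * (T / N)) / (n + 1) + L / N, by positivity⟩
  have hcontr : ContractingWith q (singularOp hT N n hf) :=
    ⟨NNReal.coe_lt_one.1 hq, LipschitzWith.of_dist_le_mul (dist_singularOp_le hT hN hL hk hf hlip)⟩
  set w := hcontr.fixedPoint
  have hfix : singularOp hT N n hf w = w := hcontr.fixedPoint_isFixedPt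
  refine ⟨weightedExtend hT N w, continuous_weightedExtend hT N w, fun r hr => ?_⟩
  have hval : weightedExtend hT N w r =
      -powerMean n (sourceAlong f (weightedExtend hT N w)) r := by
    conv_lhs => rw [weightedExtend, projIcc_of_mem hT hr, ← hfix]
    change Real.exp (N * r) • -(Real.exp (-(N * r)) • _) = _
    rw [smul_neg, smul_smul, ← Real.exp_add, add_neg_cancel, Real.exp_zero, one_smul]
  rw [hval, smul_neg, pow_succ_smul_powerMean]

end SingularIVP

section PowerMean

variable {R r : ℝ} {n : ℕ} {f g : ℝ → ℝ}

lemma intervalIntegrable_powerMean (n : ℕ) (hr : 0 ≤ r) (hg : ContinuousOn g (Icc 0 r)) :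
    IntervalIntegrable (fun τ => τ ^ n • g (r * τ)) MeasureTheory.volume 0 1 := by
  refine ContinuousOn.intervalIntegrable_of_Icc zero_le_one
    ((continuous_pow n).continuousOn.smul (hg.comp (by fun_prop) fun τ hτ => ?_))
  exact ⟨mul_nonneg hr hτ.1, mul_le_of_le_one_right hr hτ.2⟩

lemma continuousOn_powerMean (hg : ContinuousOn g (Icc 0 R)) :
    ContinuousOn (powerMean n g) (Icc 0 R) := by
  rcases lt_or_ge R 0 with hR | hR
  · simp [Icc_eq_empty (not_le.2 hR)]
  have hcont : Continuous (IccExtend hR ((Icc 0 R).domRestrict g)) :=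
    (continuousOn_iff_continuous_domRestrict.1 hg).Icc_extend'
  refine (continuous_powerMean n hcont).continuousOn.congr fun r hr => ?_
  refine intervalIntegral.integral_congr fun τ hτ => ?_
  rw [uIcc_of_le zero_le_one] at hτ
  have hmem : r * τ ∈ Icc 0 R :=
    ⟨mul_nonneg hr.1 hτ.1, (mul_le_of_le_one_right hr.1 hτ.2).trans hr.2⟩
  simp only [IccExtend_of_mem hR _ hmem, domRestrict_apply]

lemma powerMean_const (n : ℕ) (C r : ℝ) : powerMean n (fun _ => C) r = C / (n + 1) := by
  simp only [powerMean, smul_eq_mul, intervalIntegral.integral_mul_const, integral_pow]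
  simp [div_eq_inv_mul]

lemma powerMean_zero (n : ℕ) (g : ℝ → ℝ) : powerMean n g 0 = g 0 / (n + 1) := by
  simpa only [powerMean, zero_mul] using powerMean_const n (g 0) 0

lemma powerMean_mono (hr : 0 ≤ r) (hf : ContinuousOn f (Icc 0 r)) (hg : ContinuousOn g (Icc 0 r))
    (h : ∀ s ∈ Icc 0 r, f s ≤ g s) : powerMean n f r ≤ powerMean n g r :=
  intervalIntegral.integral_mono_on zero_le_one (intervalIntegrable_powerMean n hr hf)
    (intervalIntegrable_powerMean n hr hg) fun _ hτ =>
      mul_le_mul_of_nonneg_left (h _ ⟨mul_nonneg hr hτ.1, mul_le_of_le_one_right hr hτ.2⟩)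
        (pow_nonneg hτ.1 n)

lemma powerMean_pos (hr : 0 < r) (hg : ContinuousOn g (Icc 0 r)) (h : ∀ s ∈ Ioo 0 r, 0 < g s) :
    0 < powerMean n g r :=
  intervalIntegral.intervalIntegral_pos_of_pos_on (intervalIntegrable_powerMean n hr.le hg)
    (fun _ hτ => mul_pos (pow_pos hτ.1 n) (h _ ⟨mul_pos hr hτ.1, mul_lt_of_lt_one_right hr hτ.2⟩))
    zero_lt_one

end PowerMean

section RadialSystem

/-- Coefficients `B, F` for which the system `η' = 3 (δ - η) / r`,
`δ' = -B(δ, η) (δ - η) / r - r F(δ, η)` is well posed from the singular center `r = 0`. -/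
structure IsTameSystem (B F : ℝ × ℝ → ℝ) (L : NNReal) (M : ℝ) : Prop where
  shear_mem : ∀ q, B q ∈ Icc (-1 / 2) 0
  gravity_mem : ∀ q, F q ∈ Ioc 0 M
  lipschitz_shear : LipschitzWith L B
  lipschitz_gravity : LipschitzWith L F

/-- Solutions `(δ, η)` on `(0, R)` of the radial system with coefficients `B, F` that leave the
center with common value `δc` and satisfy `δ ≤ η`. -/
structure IsRadialFlow (B F : ℝ × ℝ → ℝ) (δc R : ℝ) (δ η : ℝ → ℝ) : Prop where
  hasDerivAt_mean : ∀ r ∈ Ioo 0 R, HasDerivAt η (3 * (δ r - η r) / r) r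
  hasDerivAt_density : ∀ r ∈ Ioo 0 R,
    HasDerivAt δ (-(B (δ r, η r) * (δ r - η r) / r) - r * F (δ r, η r)) r
  density_le_mean : ∀ r ∈ Ioo 0 R, δ r ≤ η r
  tendsto_density : Tendsto δ (𝓝[>] 0) (𝓝 δc)
  tendsto_mean : Tendsto η (𝓝[>] 0) (𝓝 δc)

variable {B F : ℝ × ℝ → ℝ} {L : NNReal} {M δc R T : ℝ} {δ η δ₁ η₁ δ₂ η₂ : ℝ → ℝ}

/-- The damping `(4 + b) q² / r` is nonnegative, so the singular term only helps. -/
lemma energy_rate_le {e q b G A r : ℝ} (hA : 0 ≤ A) (hR : 0 ≤ R) (hr : 0 ≤ r) (hb : -4 ≤ b)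
    (hG : |G| ≤ A * (R * |q| + |e|)) :
    2 * e * (3 * q) + 2 * q * (-((4 + b) * q / r) - G) ≤
      (3 + A * (2 * R + 1)) * (e ^ 2 + q ^ 2) := by
  have hdamp : 0 ≤ (4 + b) * q ^ 2 / r :=
    div_nonneg (mul_nonneg (by linarith) (sq_nonneg q)) hr
  have hqG : -(q * G) ≤ A * (R * q ^ 2 + |q| * |e|) := by
    calc -(q * G) ≤ |q| * |G| := by rw [← abs_mul]; exact neg_le_abs _
      _ ≤ |q| * (A * (R * |q| + |e|)) := by gcongr
      _ = A * (R * |q| ^ 2 + |q| * |e|) := by ring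
      _ = A * (R * q ^ 2 + |q| * |e|) := by rw [sq_abs]
  have hqe : 2 * (|q| * |e|) ≤ e ^ 2 + q ^ 2 := by
    linarith [two_mul_le_add_sq |q| |e|, sq_abs q, sq_abs e]
  have hRe : 0 ≤ A * (R * e ^ 2) := by positivity
  calc 2 * e * (3 * q) + 2 * q * (-((4 + b) * q / r) - G)
      = 3 * (2 * e * q) - 2 * ((4 + b) * q ^ 2 / r) + 2 * -(q * G) := by ring
    _ ≤ 3 * (e ^ 2 + q ^ 2) + 2 * (A * (R * q ^ 2 + |q| * |e|)) := by
        linarith [two_mul_le_add_sq e q]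
    _ ≤ _ := by linarith [mul_le_mul_of_nonneg_left hqe hA]

namespace IsRadialFlow

lemma mono {R' : ℝ} (h : IsRadialFlow B F δc R δ η) (hR : R' ≤ R) :
    IsRadialFlow B F δc R' δ η where
  hasDerivAt_mean r hr := h.hasDerivAt_mean r ⟨hr.1, hr.2.trans_le hR⟩
  hasDerivAt_density r hr := h.hasDerivAt_density r ⟨hr.1, hr.2.trans_le hR⟩
  density_le_mean r hr := h.density_le_mean r ⟨hr.1, hr.2.trans_le hR⟩
  tendsto_density := h.tendsto_density
  tendsto_mean := h.tendsto_mean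

lemma abs_sub_le (hBF : IsTameSystem B F L M) (h : IsRadialFlow B F δc R δ η) :
    ∀ r ∈ Ioo 0 R, |δ r - η r| ≤ M / 4 * r ^ 2 := by
  have hid : Tendsto (fun r : ℝ => r) (𝓝[>] 0) (𝓝 0) := tendsto_id.mono_left nhdsWithin_le_nhds
  have key := nonpos_of_deriv_le_mul (R := R) (C := 0)
    (Q := fun r => r ^ 2 * (η r - δ r) - M / 4 * r ^ 4)
    (Q' := fun r => -(r * (η r - δ r) * (1 + B (δ r, η r))) - r ^ 3 * (M - F (δ r, η r)))
    ?_ ?_ ?_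
  · intro r hr
    rw [abs_sub_comm, abs_of_nonneg (sub_nonneg.2 (h.density_le_mean r hr))]
    refine le_of_mul_le_mul_left ?_ (pow_pos hr.1 2)
    linarith [key r hr]
  · intro r hr
    have := hr.1.ne'
    refine (((hasDerivAt_pow 2 r).mul ((h.hasDerivAt_mean r hr).sub
      (h.hasDerivAt_density r hr))).sub ((hasDerivAt_pow 4 r).const_mul (M / 4))).congr_deriv ?_
    push_cast [Pi.sub_apply]
    field_simp
    ring
  · intro r hr
    have hshear : 0 ≤ r * (η r - δ r) * (1 + B (δ r, η r)) :=
      mul_nonneg (mul_nonneg hr.1.le (sub_nonneg.2 (h.density_le_mean r hr)))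
        (by linarith [(hBF.shear_mem (δ r, η r)).1])
    have hgrav : 0 ≤ r ^ 3 * (M - F (δ r, η r)) :=
      mul_nonneg (pow_pos hr.1 3).le (sub_nonneg.2 (hBF.gravity_mem _).2)
    linarith
  · simpa using ((hid.pow 2).mul (h.tendsto_mean.sub h.tendsto_density)).sub
      ((hid.pow 4).const_mul (M / 4))

lemma hasDerivAt_mean_sub (h₁ : IsRadialFlow B F δc R δ₁ η₁) (h₂ : IsRadialFlow B F δc R δ₂ η₂)
    {r : ℝ} (hr : r ∈ Ioo 0 R) :
    HasDerivAt (fun s => η₁ s - η₂ s) (3 * (((δ₁ r - η₁ r) - (δ₂ r - η₂ r)) / r)) r :=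
  ((h₁.hasDerivAt_mean r hr).sub (h₂.hasDerivAt_mean r hr)).congr_deriv (by ring)

lemma hasDerivAt_deficit_sub_div (h₁ : IsRadialFlow B F δc R δ₁ η₁)
    (h₂ : IsRadialFlow B F δc R δ₂ η₂) {r : ℝ} (hr : r ∈ Ioo 0 R) :
    HasDerivAt (fun s => ((δ₁ s - η₁ s) - (δ₂ s - η₂ s)) / s)
      (-((4 + B (δ₁ r, η₁ r)) * (((δ₁ r - η₁ r) - (δ₂ r - η₂ r)) / r) / r)
        - ((B (δ₁ r, η₁ r) - B (δ₂ r, η₂ r)) * ((δ₂ r - η₂ r) / r ^ 2)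
          + (F (δ₁ r, η₁ r) - F (δ₂ r, η₂ r)))) r := by
  have hr0 : r ≠ 0 := hr.1.ne'
  refine ((((h₁.hasDerivAt_density r hr).sub (h₁.hasDerivAt_mean r hr)).sub
    ((h₂.hasDerivAt_density r hr).sub (h₂.hasDerivAt_mean r hr))).div
    (hasDerivAt_id r) hr0).congr_deriv ?_
  simp only [Pi.sub_apply, id]
  field_simp
  ring

lemma tendsto_deficit_sub_div (hBF : IsTameSystem B F L M) (hR : 0 < R)
    (h₁ : IsRadialFlow B F δc R δ₁ η₁) (h₂ : IsRadialFlow B F δc R δ₂ η₂) :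
    Tendsto (fun r => ((δ₁ r - η₁ r) - (δ₂ r - η₂ r)) / r) (𝓝[>] 0) (𝓝 0) := by
  have hlim : Tendsto (fun r : ℝ => M / 2 * r) (𝓝[>] 0) (𝓝 0) := by
    have : Continuous fun r : ℝ => M / 2 * r := by fun_prop
    simpa using (this.tendsto 0).mono_left nhdsWithin_le_nhds
  refine squeeze_zero_norm' ?_ hlim
  filter_upwards [Ioo_mem_nhdsGT hR] with r hr
  rw [Real.norm_eq_abs, abs_div, abs_of_pos hr.1, div_le_iff₀ hr.1]
  refine (abs_sub _ _).trans ?_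
  linarith [h₁.abs_sub_le hBF r hr, h₂.abs_sub_le hBF r hr]

lemma abs_source_sub_le (hBF : IsTameSystem B F L M) (h₂ : IsRadialFlow B F δc R δ₂ η₂)
    (δ₁ η₁ : ℝ → ℝ) {r : ℝ} (hr : r ∈ Ioo 0 R) :
    |(B (δ₁ r, η₁ r) - B (δ₂ r, η₂ r)) * ((δ₂ r - η₂ r) / r ^ 2)
        + (F (δ₁ r, η₁ r) - F (δ₂ r, η₂ r))| ≤
      L * (M / 4 + 1) * (R * |((δ₁ r - η₁ r) - (δ₂ r - η₂ r)) / r| + |η₁ r - η₂ r|) := by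
  set e := η₁ r - η₂ r
  set q := ((δ₁ r - η₁ r) - (δ₂ r - η₂ r)) / r with hq
  have hr0 := hr.1
  have hdist : dist (δ₁ r, η₁ r) (δ₂ r, η₂ r) ≤ R * |q| + |e| := by
    have hd : δ₁ r - δ₂ r = r * q + e := by
      simp only [hq, e]
      field_simp
      ring
    have hrq : |r * q| ≤ R * |q| := by
      rw [abs_mul, abs_of_pos hr0]
      exact mul_le_mul_of_nonneg_right hr.2.le (abs_nonneg q)
    rw [Prod.dist_eq, Real.dist_eq, Real.dist_eq, hd]
    exact max_le ((abs_add_le _ _).trans (by linarith))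
      (le_add_of_nonneg_left ((abs_nonneg _).trans hrq))
  have hz : |(δ₂ r - η₂ r) / r ^ 2| ≤ M / 4 := by
    rw [abs_div, abs_of_pos (pow_pos hr0 2), div_le_iff₀ (pow_pos hr0 2)]
    exact h₂.abs_sub_le hBF r hr
  have hB := (hBF.lipschitz_shear.dist_le_mul (δ₁ r, η₁ r) (δ₂ r, η₂ r)).trans
    (mul_le_mul_of_nonneg_left hdist L.2)
  have hF := (hBF.lipschitz_gravity.dist_le_mul (δ₁ r, η₁ r) (δ₂ r, η₂ r)).trans
    (mul_le_mul_of_nonneg_left hdist L.2)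
  rw [Real.dist_eq] at hB hF
  refine (abs_add_le _ _).trans ?_
  rw [abs_mul]
  linarith [mul_le_mul hB hz (abs_nonneg _) ((abs_nonneg _).trans hB)]

theorem eqOn (hBF : IsTameSystem B F L M) (h₁ : IsRadialFlow B F δc R δ₁ η₁)
    (h₂ : IsRadialFlow B F δc R δ₂ η₂) : ∀ r ∈ Ioo 0 R, δ₁ r = δ₂ r ∧ η₁ r = η₂ r := by
  rcases le_or_gt R 0 with hR | hR
  · simp [Ioo_eq_empty (not_lt.2 hR)]
  have hM : 0 ≤ M := (hBF.gravity_mem 0).1.le.trans (hBF.gravity_mem 0).2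
  set e : ℝ → ℝ := fun r => η₁ r - η₂ r with he
  set q : ℝ → ℝ := fun r => ((δ₁ r - η₁ r) - (δ₂ r - η₂ r)) / r with hq
  have energy_nonpos := nonpos_of_deriv_le_mul
    (fun r hr => ((h₁.hasDerivAt_mean_sub h₂ hr).pow 2).add
      ((h₁.hasDerivAt_deficit_sub_div h₂ hr).pow 2))
    (C := 3 + L * (M / 4 + 1) * (2 * R + 1)) ?_ ?_
  · intro r hr
    have henergy : e r ^ 2 + q r ^ 2 ≤ 0 := energy_nonpos r hr
    have e0 : e r = 0 := by nlinarith [sq_nonneg (e r), sq_nonneg (q r)]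
    have q0 : q r = 0 := by nlinarith [sq_nonneg (e r), sq_nonneg (q r)]
    simp only [he] at e0
    simp only [hq, div_eq_zero_iff, hr.1.ne', or_false] at q0
    constructor <;> linarith
  · intro r hr
    have hb : -4 ≤ B (δ₁ r, η₁ r) := by linarith [(hBF.shear_mem (δ₁ r, η₁ r)).1]
    have hrate := energy_rate_le (by positivity : 0 ≤ L * (M / 4 + 1)) hR.le hr.1.le hb
      (h₂.abs_source_sub_le hBF δ₁ η₁ hr)
    refine le_trans (le_of_eq ?_) hrate
    push_cast
    ring
  · have he0 : Tendsto e (𝓝[>] 0) (𝓝 0) := by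
      simpa only [sub_self] using h₁.tendsto_mean.sub h₂.tendsto_mean
    have hsum := (he0.pow 2).add ((h₁.tendsto_deficit_sub_div hBF hR h₂).pow 2)
    rwa [zero_pow two_ne_zero, add_zero] at hsum

end IsRadialFlow

/-- The mean compression `η` determined by `v = (δ - η) / r²`, since `η' = 3 (δ - η) / r`. -/
def meanOf (δc : ℝ) (v : ℝ → ℝ) (r : ℝ) : ℝ := δc + 3 * firstMoment v r

/-- The compression `δ` determined by `v = (δ - η) / r²`. -/
def densityOf (δc : ℝ) (v : ℝ → ℝ) (r : ℝ) : ℝ := meanOf δc v r + r ^ 2 * v r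

variable {v : ℝ → ℝ}

lemma hasDerivAt_meanOf (hv : Continuous v) (r : ℝ) :
    HasDerivAt (meanOf δc v) (3 * (r * v r)) r :=
  ((hasDerivAt_firstMoment hv r).const_mul 3).const_add δc

lemma continuous_meanOf (hv : Continuous v) : Continuous (meanOf δc v) :=
  ((continuous_firstMoment hv).const_mul 3).const_add δc

lemma continuous_densityOf (hv : Continuous v) : Continuous (densityOf δc v) :=
  (continuous_meanOf hv).add ((continuous_pow 2).mul hv)

lemma meanOf_zero (δc : ℝ) (v : ℝ → ℝ) : meanOf δc v 0 = δc := by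
  simp [meanOf, firstMoment]

lemma densityOf_zero (δc : ℝ) (v : ℝ → ℝ) : densityOf δc v 0 = δc := by
  simp [densityOf, meanOf_zero]

/-- The pair `(δ, η)` determined by `v = (δ - η) / r²` and `x = ∫₀ʳ t v(t) dt`. -/
def deficitState (δc r x v : ℝ) : ℝ × ℝ := (δc + 3 * x + r ^ 2 * v, δc + 3 * x)

/-- The source term of the equation for `v = (δ - η) / r²`. Truncating `v` to `[-M, 0]`, where the
solution turns out to stay, makes it globally Lipschitz. -/
def deficitSource (B F : ℝ × ℝ → ℝ) (M δc r x v : ℝ) : ℝ :=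
  B (deficitState δc r x v) * max (-M) (min v 0) + F (deficitState δc r x v)

lemma dist_deficitState_le {r : ℝ} (hr : r ∈ Icc 0 T) (δc x x' v v' : ℝ) :
    dist (deficitState δc r x v) (deficitState δc r x' v') ≤
      (T + 3) * (|x - x'| + r * |v - v'|) := by
  have hr0 := hr.1
  have hT := hr.1.trans hr.2
  have hfst : |δc + 3 * x + r ^ 2 * v - (δc + 3 * x' + r ^ 2 * v')| ≤
      3 * |x - x'| + r ^ 2 * |v - v'| := by
    have habs := abs_add_le (3 * (x - x')) (r ^ 2 * (v - v'))
    rw [abs_mul, abs_mul, abs_of_nonneg (sq_nonneg r),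
      abs_of_pos (three_pos : (0 : ℝ) < 3)] at habs
    exact (congrArg abs (by ring)).trans_le habs
  have hsnd : |δc + 3 * x - (δc + 3 * x')| = 3 * |x - x'| := by
    rw [add_sub_add_left_eq_sub, ← mul_sub, abs_mul, abs_of_pos (three_pos : (0 : ℝ) < 3)]
  have hxT : 0 ≤ T * |x - x'| := by positivity
  have hrv : 0 ≤ r * |v - v'| := by positivity
  have hrT : r ^ 2 * |v - v'| ≤ T * (r * |v - v'|) := by
    rw [pow_two, mul_assoc]
    exact mul_le_mul_of_nonneg_right hr.2 hrv
  rw [deficitState, deficitState, Prod.dist_eq, Real.dist_eq, Real.dist_eq, hsnd]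
  exact max_le (by linarith) (by linarith [mul_nonneg hT hrv])

/-- The integrated equation for `v` is the equation `r v' = -5 v - f`, which is the equation for
`δ` divided by `r`. -/
lemma hasDerivAt_densityOf {v Φ : ℝ → ℝ} (hv : Continuous v) (hΦ : Continuous Φ)
    (hint : ∀ r ∈ Icc 0 T, r ^ 5 * v r = -∫ s in (0 : ℝ)..r, s ^ 4 * Φ s) {r : ℝ}
    (hr : r ∈ Ioo 0 T) : HasDerivAt (densityOf δc v) (-(r * Φ r)) r := by
  have hr0 : r ≠ 0 := hr.1.ne'
  have hJ : HasDerivAt (fun r => ∫ s in (0 : ℝ)..r, s ^ 4 * Φ s) (r ^ 4 * Φ r) r :=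
    (((continuous_pow 4).mul hΦ).integral_hasStrictDerivAt 0 r).hasDerivAt
  refine (((hasDerivAt_meanOf (δc := δc) hv r).add (hJ.neg.div (hasDerivAt_pow 3 r)
    (pow_ne_zero 3 hr0))).congr_of_eventuallyEq ?_).congr_deriv ?_
  · filter_upwards [Ioo_mem_nhds hr.1 hr.2] with s hs
    have := hs.1.ne'
    simp only [densityOf, Pi.add_apply, Pi.div_apply, Pi.neg_apply,
      ← hint s (Ioo_subset_Icc_self hs)]
    field_simp
  · simp only [Pi.neg_apply, ← hint r (Ioo_subset_Icc_self hr)]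
    push_cast
    field_simp
    ring

lemma mem_Ico_of_pow_mul_eq_neg_integral {v Φ : ℝ → ℝ} (hΦ : Continuous Φ)
    (hmem : ∀ s, Φ s ∈ Ioc 0 (5 * M)) {r : ℝ} (hr : 0 < r)
    (hint : r ^ 5 * v r = -∫ s in (0 : ℝ)..r, s ^ 4 * Φ s) :
    v r ∈ Ico (-M) 0 := by
  have h5 : 0 < r ^ 5 := pow_pos hr 5
  have hΦi : IntervalIntegrable (fun s => s ^ 4 * Φ s) MeasureTheory.volume 0 r :=
    Continuous.intervalIntegrable (by fun_prop) _ _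
  have hpos : 0 < ∫ s in (0 : ℝ)..r, s ^ 4 * Φ s :=
    intervalIntegral.intervalIntegral_pos_of_pos_on hΦi
      (fun s hs => mul_pos (pow_pos hs.1 4) (hmem s).1) hr
  have hle : ∫ s in (0 : ℝ)..r, s ^ 4 * Φ s ≤ r ^ 5 * M := by
    calc _ ≤ ∫ s in (0 : ℝ)..r, s ^ 4 * (5 * M) :=
          intervalIntegral.integral_mono_on hr.le hΦi
            (Continuous.intervalIntegrable (by fun_prop) _ _)
            fun s hs => mul_le_mul_of_nonneg_left (hmem s).2 (pow_nonneg hs.1 4)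
      _ = r ^ 5 * M := by
          rw [intervalIntegral.integral_mul_const, integral_pow]
          push_cast
          ring
  constructor
  · exact le_of_mul_le_mul_left (by linarith) h5
  · exact neg_of_mul_neg_right (by linarith) h5.le

namespace IsTameSystem

lemma max_nonneg (h : IsTameSystem B F L M) : 0 ≤ M :=
  (h.gravity_mem 0).1.le.trans (h.gravity_mem 0).2

lemma continuous_deficitSource (h : IsTameSystem B F L M) (δc : ℝ) :
    Continuous fun p : ℝ × ℝ × ℝ => deficitSource B F M δc p.1 p.2.1 p.2.2 := by
  have := h.lipschitz_shear.continuous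
  have := h.lipschitz_gravity.continuous
  unfold deficitSource deficitState
  fun_prop

lemma deficitSource_mem (h : IsTameSystem B F L M) (δc r x v : ℝ) :
    deficitSource B F M δc r x v ∈ Ioc 0 (5 * M) := by
  have hM := h.max_nonneg
  have hB := h.shear_mem (deficitState δc r x v)
  have hF := h.gravity_mem (deficitState δc r x v)
  have hlow : -M ≤ max (-M) (min v 0) := le_max_left _ _
  have hup : max (-M) (min v 0) ≤ 0 := max_le (by linarith) (min_le_right _ _)
  unfold deficitSource
  constructor <;> nlinarith [hB.1, hB.2, hF.1, hF.2]

lemma norm_deficitSource_sub_le (h : IsTameSystem B F L M) {r : ℝ} (hr : r ∈ Icc 0 T)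
    (x x' v v' : ℝ) :
    ‖deficitSource B F M δc r x v - deficitSource B F M δc r x' v'‖ ≤
      L * (M + 1) * (T + 3) * ‖x - x'‖ + (1 / 2 + L * (M + 1) * (T + 3) * r) * ‖v - v'‖ := by
  simp only [Real.norm_eq_abs, deficitSource]
  have hM := h.max_nonneg
  have hr0 := hr.1
  have hT := hr.1.trans hr.2
  set p := deficitState δc r x v
  set p' := deficitState δc r x' v'
  set w := max (-M) (min v 0)
  set w' := max (-M) (min v' 0)
  have hw' : |w'| ≤ M :=
    abs_le.2 ⟨le_max_left _ _, max_le (by linarith) ((min_le_right _ _).trans hM)⟩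
  have hww' : |w - w'| ≤ |v - v'| := by
    have hlip := (LipschitzWith.id.min_const (0 : ℝ)).const_max (-M)
    simpa only [NNReal.coe_one, one_mul, Real.dist_eq, id] using hlip.dist_le_mul v v'
  have hB : |B p| ≤ 1 / 2 :=
    abs_le.2 ⟨by linarith [(h.shear_mem p).1], by linarith [(h.shear_mem p).2]⟩
  have hpp' : dist p p' ≤ (T + 3) * (|x - x'| + r * |v - v'|) :=
    dist_deficitState_le hr δc x x' v v'
  have hBp := (h.lipschitz_shear.dist_le_mul p p').trans (mul_le_mul_of_nonneg_left hpp' L.2)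
  have hFp := (h.lipschitz_gravity.dist_le_mul p p').trans (mul_le_mul_of_nonneg_left hpp' L.2)
  rw [Real.dist_eq] at hBp hFp
  calc |B p * w + F p - (B p' * w' + F p')|
      = |B p * (w - w') + (B p - B p') * w' + (F p - F p')| := by congr 1; ring
    _ ≤ |B p| * |w - w'| + |B p - B p'| * |w'| + |F p - F p'| := by
        rw [← abs_mul, ← abs_mul]; exact abs_add_three _ _ _
    _ ≤ 1 / 2 * |v - v'| + L * ((T + 3) * (|x - x'| + r * |v - v'|)) * M
        + L * ((T + 3) * (|x - x'| + r * |v - v'|)) := by gcongr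
    _ = _ := by ring

theorem exists_isRadialFlow (h : IsTameSystem B F L M) (hT : 0 ≤ T) (δc : ℝ) :
    ∃ v : ℝ → ℝ, Continuous v ∧ (∀ r ∈ Ioc 0 T, v r < 0) ∧
      IsRadialFlow B F δc T (densityOf δc v) (meanOf δc v) := by
  have hM := h.max_nonneg
  obtain ⟨v, hv, hint⟩ := exists_singular_ivp 4 hT (by positivity) (by norm_num) (by norm_num)
    (h.continuous_deficitSource δc) fun r hr => h.norm_deficitSource_sub_le hr
  have hΦ := continuous_sourceAlong (h.continuous_deficitSource δc) hv
  have hmem (r) (hr : r ∈ Ioc 0 T) : v r ∈ Ico (-M) 0 :=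
    mem_Ico_of_pow_mul_eq_neg_integral hΦ (fun s => h.deficitSource_mem δc s _ _) hr.1
      (hint r (Ioc_subset_Icc_self hr))
  have hsub (r) : densityOf δc v r - meanOf δc v r = r ^ 2 * v r := by rw [densityOf]; ring
  refine ⟨v, hv, fun r hr => (hmem r hr).2, fun r hr => ?_, fun r hr => ?_, fun r hr => ?_, ?_, ?_⟩
  · refine (hasDerivAt_meanOf hv r).congr_deriv ?_
    have := hr.1.ne'
    rw [hsub]
    field_simp
  · refine (hasDerivAt_densityOf hv hΦ hint hr).congr_deriv ?_
    have hvr := hmem r (Ioo_subset_Ioc_self hr)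
    have hsrc : sourceAlong (deficitSource B F M δc) v r =
        B (densityOf δc v r, meanOf δc v r) * v r + F (densityOf δc v r, meanOf δc v r) := by
      rw [sourceAlong, deficitSource, min_eq_left hvr.2.le, max_eq_right hvr.1]
      rfl
    have := hr.1.ne'
    rw [hsrc, hsub]
    field_simp
    ring
  · have := mul_nonpos_of_nonneg_of_nonpos (sq_nonneg r) (hmem r (Ioo_subset_Ioc_self hr)).2.le
    linarith [hsub r]
  · simpa only [densityOf_zero] using
      ((continuous_densityOf (δc := δc) hv).tendsto 0).mono_left nhdsWithin_le_nhds
  · simpa only [meanOf_zero] using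
      ((continuous_meanOf (δc := δc) hv).tendsto 0).mono_left nhdsWithin_le_nhds

end IsTameSystem

end RadialSystem

/-- The function `h` in `p_rad(δ, η) = λ + 2μ - h(η) / δ`. -/
def radProfile (lam mu η : ℝ) : ℝ :=
  2 * (lam + mu) * η ^ (2 / 3 : ℝ) - lam * η ^ (4 / 3 : ℝ)

/-- The function `g` in `p_tan - p_rad = g(η) (1 / δ - δ / η²)`. -/
def shearProfile (lam mu η : ℝ) : ℝ :=
  (lam + mu) * η ^ (2 / 3 : ℝ) - lam * η ^ (4 / 3 : ℝ)

/-- The radial constitutive function in closed form, without derivatives of the energy. -/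
def radPressure (lam mu δ η : ℝ) : ℝ := lam + 2 * mu - radProfile lam mu η / δ

/-- The tangential constitutive function in closed form. -/
def tanPressure (lam mu δ η : ℝ) : ℝ :=
  radPressure lam mu δ η + shearProfile lam mu η * (1 / δ - δ / η ^ 2)

/-- The density `Δ_♯ = ((λ + μ) / λ) ^ (3 / 2)`, the zero of `shearProfile` on `(0, ∞)`. -/
def criticalDensity (lam mu : ℝ) : ℝ := ((lam + mu) / lam) ^ (3 / 2 : ℝ)

section Constitutive

variable {lam mu δ η : ℝ}

lemma rpow_four_thirds (hη : 0 ≤ η) : η ^ (4 / 3 : ℝ) = (η ^ (2 / 3 : ℝ)) ^ 2 := by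
  rw [← Real.rpow_mul_natCast hη]; norm_num

lemma rpow_two_thirds_pow_three (hη : 0 ≤ η) : (η ^ (2 / 3 : ℝ)) ^ 3 = η ^ 2 := by
  rw [← Real.rpow_mul_natCast hη]; norm_num

lemma hadamardEnergy_eq (hδ : δ ≠ 0) (hη : 0 < η) :
    hadamardEnergy lam mu δ η =
      (lam + mu) * η ^ (2 / 3 : ℝ) / δ ^ 2 + 1 / 2 * (lam + mu) * η ^ (-4 / 3 : ℝ)
        - (lam + 2 * mu) / δ - 1 / 2 * lam * η ^ (4 / 3 : ℝ) / δ ^ 2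
        - lam * η ^ (-2 / 3 : ℝ) + 1 / 2 * (2 * lam + mu) := by
  set x := η ^ (1 / 3 : ℝ) with hx
  have hx0 : 0 < x := Real.rpow_pos_of_pos hη _
  have e1 : η = x ^ 3 := by rw [hx, ← Real.rpow_mul_natCast hη.le]; norm_num
  have e2 : η ^ (2 / 3 : ℝ) = x ^ 2 := by rw [hx, ← Real.rpow_mul_natCast hη.le]; norm_num
  have e4 : η ^ (4 / 3 : ℝ) = x ^ 4 := by rw [hx, ← Real.rpow_mul_natCast hη.le]; norm_num
  have e2' : η ^ (-2 / 3 : ℝ) = (x ^ 2)⁻¹ := by rw [neg_div, Real.rpow_neg hη.le, e2]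
  have e4' : η ^ (-4 / 3 : ℝ) = (x ^ 4)⁻¹ := by rw [neg_div, Real.rpow_neg hη.le, e4]
  rw [hadamardEnergy, ← hx, e2, e4, e2', e4', e1, hadamardW]
  field_simp
  ring

lemma hasDerivAt_hadamardEnergy_fst (hδ : 0 < δ) (hη : 0 < η) :
    HasDerivAt (fun d => hadamardEnergy lam mu d η) (radPressure lam mu δ η / δ ^ 2) δ := by
  have hinv := hasDerivAt_inv hδ.ne'
  have key := (((hinv.pow 2).const_mul
    ((lam + mu) * η ^ (2 / 3 : ℝ) - 1 / 2 * lam * η ^ (4 / 3 : ℝ))).sub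
    (hinv.const_mul (lam + 2 * mu))).add_const
    (1 / 2 * (lam + mu) * η ^ (-4 / 3 : ℝ) - lam * η ^ (-2 / 3 : ℝ) + 1 / 2 * (2 * lam + mu))
  refine (key.congr_of_eventuallyEq ?_).congr_deriv ?_
  · filter_upwards [lt_mem_nhds hδ] with d hd
    rw [hadamardEnergy_eq hd.ne' hη]
    simp only [Pi.sub_apply, Pi.pow_apply]
    ring
  · unfold radPressure radProfile
    norm_num
    field_simp
    ring

lemma hasDerivAt_hadamardEnergy_snd (hδ : 0 < δ) (hη : 0 < η) :
    HasDerivAt (fun e => hadamardEnergy lam mu δ e)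
      (2 / 3 * shearProfile lam mu η * (1 / δ - δ / η ^ 2) / (δ * η)) η := by
  have hp (p : ℝ) := Real.hasDerivAt_rpow_const (x := η) (p := p) (Or.inl hη.ne')
  have key := ((((hp (2 / 3)).const_mul ((lam + mu) / δ ^ 2)).add
    ((hp (-4 / 3)).const_mul (1 / 2 * (lam + mu)))).sub
    ((hp (4 / 3)).const_mul (1 / 2 * lam / δ ^ 2))).sub ((hp (-2 / 3)).const_mul lam)
    |>.add_const (1 / 2 * (2 * lam + mu) - (lam + 2 * mu) / δ)
  refine (key.congr_of_eventuallyEq ?_).congr_deriv ?_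
  · filter_upwards [lt_mem_nhds hη] with e he
    rw [hadamardEnergy_eq hδ.ne' he]
    simp only [Pi.sub_apply, Pi.add_apply]
    ring
  · have e1 : η ^ (-4 / 3 : ℝ) = η ^ (2 / 3 : ℝ) / η ^ 2 := by
      rw [← Real.rpow_natCast η 2, ← Real.rpow_sub hη]; norm_num
    have e2 : η ^ (-2 / 3 : ℝ) = η ^ (4 / 3 : ℝ) / η ^ 2 := by
      rw [← Real.rpow_natCast η 2, ← Real.rpow_sub hη]; norm_num
    simp only [Real.rpow_sub_one hη.ne', e1, e2, shearProfile]
    field_simp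
    ring

lemma hadamardRad_eq (hδ : 0 < δ) (hη : 0 < η) :
    hadamardRad lam mu δ η = radPressure lam mu δ η := by
  unfold hadamardRad hyperelasticRad
  rw [(hasDerivAt_hadamardEnergy_fst hδ hη).deriv]
  field_simp

lemma hadamardTan_eq (hδ : 0 < δ) (hη : 0 < η) :
    hadamardTan lam mu δ η = tanPressure lam mu δ η := by
  change hadamardRad lam mu δ η + 3 / 2 * δ * η * _ = _
  rw [hadamardRad_eq hδ hη, (hasDerivAt_hadamardEnergy_snd hδ hη).deriv, tanPressure]
  field_simp

lemma deriv_hadamardRad_fst (hδ : 0 < δ) (hη : 0 < η) :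
    deriv (fun d => hadamardRad lam mu d η) δ = radProfile lam mu η / δ ^ 2 := by
  have key := ((hasDerivAt_inv hδ.ne').const_mul (radProfile lam mu η)).const_sub (lam + 2 * mu)
  refine ((key.congr_of_eventuallyEq ?_).congr_deriv (by field_simp)).deriv
  filter_upwards [lt_mem_nhds hδ] with d hd
  rw [hadamardRad_eq hd hη, radPressure, div_eq_mul_inv]

lemma contDiffAt_radProfile (hη : 0 < η) : ContDiffAt ℝ 1 (radProfile lam mu) η :=
  (contDiffAt_const.mul (Real.contDiffAt_rpow_const_of_ne hη.ne')).sub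
    (contDiffAt_const.mul (Real.contDiffAt_rpow_const_of_ne hη.ne'))

lemma contDiffAt_shearProfile (hη : 0 < η) : ContDiffAt ℝ 1 (shearProfile lam mu) η :=
  (contDiffAt_const.mul (Real.contDiffAt_rpow_const_of_ne hη.ne')).sub
    (contDiffAt_const.mul (Real.contDiffAt_rpow_const_of_ne hη.ne'))

lemma contDiffAt_radPressure {q : ℝ × ℝ} (h1 : 0 < q.1) (h2 : 0 < q.2) :
    ContDiffAt ℝ 1 (fun q : ℝ × ℝ => radPressure lam mu q.1 q.2) q :=
  contDiffAt_const.sub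
    (((contDiffAt_radProfile h2).comp q contDiffAt_snd).div contDiffAt_fst h1.ne')

lemma contDiffAt_tanPressure {q : ℝ × ℝ} (h1 : 0 < q.1) (h2 : 0 < q.2) :
    ContDiffAt ℝ 1 (fun q : ℝ × ℝ => tanPressure lam mu q.1 q.2) q :=
  (contDiffAt_radPressure h1 h2).add
    (((contDiffAt_shearProfile h2).comp q contDiffAt_snd).mul
      ((contDiffAt_const.div contDiffAt_fst h1.ne').sub
        (contDiffAt_fst.div (contDiffAt_snd.pow 2) (pow_pos h2 2).ne')))

lemma contDiffOn_hadamardRad :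
    ContDiffOn ℝ 1 (fun q : ℝ × ℝ => hadamardRad lam mu q.1 q.2) (Ioi 0 ×ˢ Ioi 0) :=
  ContDiffOn.congr (fun _ hq => (contDiffAt_radPressure hq.1 hq.2).contDiffWithinAt)
    fun _ hq => hadamardRad_eq hq.1 hq.2

lemma contDiffOn_hadamardTan :
    ContDiffOn ℝ 1 (fun q : ℝ × ℝ => hadamardTan lam mu q.1 q.2) (Ioi 0 ×ˢ Ioi 0) :=
  ContDiffOn.congr (fun _ hq => (contDiffAt_tanPressure hq.1 hq.2).contDiffWithinAt)
    fun _ hq => hadamardTan_eq hq.1 hq.2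

lemma tanPressure_self (lam mu η : ℝ) : tanPressure lam mu η η = radPressure lam mu η η := by
  have : 1 / η - η / η ^ 2 = 0 := by
    rcases eq_or_ne η 0 with rfl | hη
    · simp
    · field_simp; ring
  rw [tanPressure, this, mul_zero, add_zero]

lemma shearProfile_eq_mul (hη : 0 ≤ η) :
    shearProfile lam mu η = η ^ (2 / 3 : ℝ) * (lam + mu - lam * η ^ (2 / 3 : ℝ)) := by
  rw [shearProfile, rpow_four_thirds hη]; ring

lemma radProfile_eq_add (lam mu η : ℝ) :
    radProfile lam mu η = shearProfile lam mu η + (lam + mu) * η ^ (2 / 3 : ℝ) := by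
  unfold radProfile shearProfile; ring

lemma hasDerivAt_radProfile (hη : 0 < η) :
    HasDerivAt (radProfile lam mu) (4 / 3 * shearProfile lam mu η / η) η := by
  have hp (p : ℝ) := Real.hasDerivAt_rpow_const (x := η) (p := p) (Or.inl hη.ne')
  refine (((hp (2 / 3)).const_mul (2 * (lam + mu))).sub
    ((hp (4 / 3)).const_mul lam)).congr_deriv ?_
  rw [Real.rpow_sub_one hη.ne', Real.rpow_sub_one hη.ne', shearProfile]
  ring

lemma radPressure_self_pos_iff (hlam : 0 < lam) (hmu : 0 < lam + mu) (hη : 0 < η) :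
    0 < radPressure lam mu η η ↔ 1 < η := by
  set x := η ^ (1 / 3 : ℝ) with hx
  have hx0 : 0 < x := Real.rpow_pos_of_pos hη _
  have e1 : η = x ^ 3 := by rw [hx, ← Real.rpow_mul_natCast hη.le]; norm_num
  have e2 : η ^ (2 / 3 : ℝ) = x ^ 2 := by rw [hx, ← Real.rpow_mul_natCast hη.le]; norm_num
  have factored : radPressure lam mu η η =
      (lam * x + 2 * (lam + mu)) * (x - 1) / x := by
    rw [radPressure, radProfile, rpow_four_thirds hη.le, e2, e1]
    field_simp
    ring
  have hpos : 0 < lam * x + 2 * (lam + mu) := by positivity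
  rw [factored, div_pos_iff_of_pos_right hx0, mul_pos_iff_of_pos_left hpos, sub_pos, e1,
    one_lt_pow_iff_of_nonneg hx0.le three_ne_zero]

lemma one_lt_criticalDensity_iff (hlam : 0 < lam) (hmu : 0 < lam + mu) :
    1 < criticalDensity lam mu ↔ 0 < mu := by
  rw [criticalDensity, Real.one_lt_rpow_iff_of_pos (by positivity), one_lt_div hlam]
  norm_num

lemma shearProfile_pos (hlam : 0 < lam) (hmu : 0 < lam + mu) (hη : 0 < η)
    (hc : η < criticalDensity lam mu) : 0 < shearProfile lam mu η := by
  have hq : 0 < (lam + mu) / lam := by positivity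
  have hu : η ^ (2 / 3 : ℝ) < (lam + mu) / lam := by
    have := Real.rpow_lt_rpow hη.le hc (by norm_num : (0 : ℝ) < 2 / 3)
    rwa [criticalDensity, ← Real.rpow_mul hq.le, show (3 / 2 : ℝ) * (2 / 3) = 1 by norm_num,
      Real.rpow_one] at this
  rw [lt_div_iff₀ hlam] at hu
  rw [shearProfile_eq_mul hη.le]
  exact mul_pos (Real.rpow_pos_of_pos hη _) (by linarith)

lemma shearProfile_lt_radProfile (hmu : 0 < lam + mu) (hη : 0 < η) :
    shearProfile lam mu η < radProfile lam mu η := by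
  have : 0 < (lam + mu) * η ^ (2 / 3 : ℝ) := mul_pos hmu (Real.rpow_pos_of_pos hη _)
  rw [radProfile_eq_add]
  linarith

lemma radProfile_pos (hlam : 0 < lam) (hmu : 0 < lam + mu) (hη : 0 < η)
    (hc : η < criticalDensity lam mu) : 0 < radProfile lam mu η :=
  (shearProfile_pos hlam hmu hη hc).trans (shearProfile_lt_radProfile hmu hη)

lemma lt_radProfile (hlam : 0 < lam) (hmu : 0 < lam + mu) (hη : 1 ≤ η)
    (hc : η < criticalDensity lam mu) : lam + mu < radProfile lam mu η := by
  have hg := shearProfile_pos hlam hmu (by linarith) hc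
  have hu : 1 ≤ η ^ (2 / 3 : ℝ) := Real.one_le_rpow hη (by norm_num)
  rw [radProfile_eq_add]
  nlinarith

end Constitutive

section Equilibrium

/-- The coefficient of `-(δ - η) / r` in the equation for `δ'`. -/
def shearCoeff (lam mu δ η : ℝ) : ℝ :=
  2 * shearProfile lam mu η * δ * (δ - η) / (radProfile lam mu η * η ^ 2)

/-- The coefficient of `-r` in the equation for `δ'`, where `κ = 4π / 3 * K²`. -/
def gravityCoeff (lam mu κ δ η : ℝ) : ℝ := κ * δ ^ 3 * η / radProfile lam mu η

variable {lam mu κ r δ' : ℝ} {δ η : ℝ → ℝ}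

lemma hasDerivAt_radPressure_comp (hr : r ≠ 0) (hδ : 0 < δ r) (hη : 0 < η r)
    (hδ' : HasDerivAt δ δ' r) (hη' : HasDerivAt η (3 * (δ r - η r) / r) r) :
    HasDerivAt (fun s => radPressure lam mu (δ s) (η s))
      (radProfile lam mu (η r) * δ' / δ r ^ 2
        - 4 * shearProfile lam mu (η r) * (δ r - η r) / (η r * r * δ r)) r := by
  have hh := (hasDerivAt_radProfile (lam := lam) (mu := mu) hη).comp r hη'
  refine ((hh.div hδ' hδ.ne').const_sub (lam + 2 * mu)).congr_deriv ?_
  simp only [Function.comp]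
  field_simp
  ring

/-- The two equations differ by the nonzero factor `h / δ²`. -/
lemma equilibrium_iff {d e : ℝ} (hr : 0 < r) (hd : 0 < d) (he : 0 < e)
    (hh : 0 < radProfile lam mu e) :
    radProfile lam mu e * δ' / d ^ 2 - 4 * shearProfile lam mu e * (d - e) / (e * r * d) =
      -(2 / r) * (radPressure lam mu d e - tanPressure lam mu d e) - κ * d * e * r ↔
    δ' = -(shearCoeff lam mu d e * (d - e) / r) - r * gravityCoeff lam mu κ d e := by
  unfold tanPressure shearCoeff gravityCoeff
  set h := radProfile lam mu e
  set g := shearProfile lam mu e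
  set P := radPressure lam mu d e
  have factored : h * δ' / d ^ 2 - 4 * g * (d - e) / (e * r * d)
      - (-(2 / r) * (P - (P + g * (1 / d - d / e ^ 2))) - κ * d * e * r) =
      h / d ^ 2 * (δ' - (-(2 * g * d * (d - e) / (h * e ^ 2) * (d - e) / r)
        - r * (κ * d ^ 3 * e / h))) := by
    field_simp
    ring
  have hne : h / d ^ 2 ≠ 0 := by positivity
  rw [← sub_eq_zero, factored, mul_eq_zero, or_iff_right hne, sub_eq_zero]

end Equilibrium

section Coefficients

variable {lam mu κ δc : ℝ} {q : ℝ × ℝ}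

lemma contDiffAt_shearCoeff (hq : 0 < q.2) (hh : radProfile lam mu q.2 ≠ 0) :
    ContDiffAt ℝ 1 (fun q : ℝ × ℝ => shearCoeff lam mu q.1 q.2) q :=
  (((contDiffAt_const.mul ((contDiffAt_shearProfile hq).comp q contDiffAt_snd)).mul
    contDiffAt_fst).mul (contDiffAt_fst.sub contDiffAt_snd)).div
      (((contDiffAt_radProfile hq).comp q contDiffAt_snd).mul (contDiffAt_snd.pow 2))
      (mul_ne_zero hh (pow_pos hq 2).ne')

lemma contDiffAt_gravityCoeff (hq : 0 < q.2) (hh : radProfile lam mu q.2 ≠ 0) :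
    ContDiffAt ℝ 1 (fun q : ℝ × ℝ => gravityCoeff lam mu κ q.1 q.2) q :=
  ((contDiffAt_const.mul (contDiffAt_fst.pow 3)).mul contDiffAt_snd).div
    ((contDiffAt_radProfile hq).comp q contDiffAt_snd) hh

lemma shearCoeff_mem {d e : ℝ} (hlam : 0 < lam) (hmu : 0 < lam + mu) (hd : 0 < d) (hde : d ≤ e)
    (he : e < criticalDensity lam mu) : shearCoeff lam mu d e ∈ Icc (-1 / 2) 0 := by
  have he0 : 0 < e := hd.trans_le hde
  have hg := shearProfile_pos hlam hmu he0 he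
  have hgh := shearProfile_lt_radProfile hmu he0
  have hh := hg.trans hgh
  have hden : 0 < radProfile lam mu e * e ^ 2 := by positivity
  have := sub_nonneg.2 hde
  unfold shearCoeff
  constructor
  · have hsq : 4 * d * (e - d) ≤ e ^ 2 := by nlinarith [sq_nonneg (e - 2 * d)]
    have hprod : shearProfile lam mu e * (4 * d * (e - d)) ≤ radProfile lam mu e * e ^ 2 :=
      mul_le_mul hgh.le hsq (by positivity) hh.le
    rw [le_div_iff₀ hden]
    linarith
  · exact div_nonpos_of_nonpos_of_nonneg
      (mul_nonpos_of_nonneg_of_nonpos (by positivity) (by linarith)) hden.le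

lemma gravityCoeff_pos {d e : ℝ} (hκ : 0 < κ) (hd : 0 < d) (he : 0 < e)
    (hh : 0 < radProfile lam mu e) : 0 < gravityCoeff lam mu κ d e := by
  unfold gravityCoeff; positivity

/-- Lower bound of the compression `δ` where `1 ≤ η < Δ_♯` and the radial pressure is
nonnegative. -/
def minDensity (lam mu : ℝ) : ℝ := (lam + mu) / (lam + 2 * mu)

/-- The values `(δ, η)` taken inside a ball of central compression `δc`. -/
def admissibleRegion (lam mu δc : ℝ) : Set (ℝ × ℝ) :=
  {q | minDensity lam mu ≤ q.1 ∧ q.1 ≤ q.2 ∧ 1 ≤ q.2 ∧ q.2 ≤ δc}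

lemma isCompact_admissibleRegion (lam mu δc : ℝ) : IsCompact (admissibleRegion lam mu δc) := by
  refine (isCompact_Icc.prod isCompact_Icc :
    IsCompact (Icc (minDensity lam mu) δc ×ˢ Icc 1 δc)).of_isClosed_subset ?_ ?_
  · exact (isClosed_le continuous_const continuous_fst).inter
      ((isClosed_le continuous_fst continuous_snd).inter
        ((isClosed_le continuous_const continuous_snd).inter
          (isClosed_le continuous_snd continuous_const)))
  · exact fun q ⟨hmin, hle, h1, hc⟩ => ⟨⟨hmin, hle.trans hc⟩, h1, hc⟩

theorem exists_isTameSystem (hlam : 0 < lam) (hmu : 0 < lam + 2 * mu) (hκ : 0 < κ)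
    (hc : δc < criticalDensity lam mu) :
    ∃ (B F : ℝ × ℝ → ℝ) (L : NNReal) (m M : ℝ), IsTameSystem B F L M ∧
      0 < m ∧ (∀ q, m ≤ F q) ∧
      EqOn B (fun q => shearCoeff lam mu q.1 q.2) (admissibleRegion lam mu δc) ∧
      EqOn F (fun q => gravityCoeff lam mu κ q.1 q.2) (admissibleRegion lam mu δc) := by
  set region := admissibleRegion lam mu δc
  have hcompact : IsCompact region := isCompact_admissibleRegion lam mu δc
  have hmu' : 0 < lam + mu := by linarith
  have hpos (q) (hq : q ∈ region) : 0 < q.1 ∧ 0 < q.2 ∧ 0 < radProfile lam mu q.2 :=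
    ⟨(div_pos hmu' hmu).trans_le hq.1, zero_lt_one.trans_le hq.2.2.1,
      radProfile_pos hlam hmu' (zero_lt_one.trans_le hq.2.2.1) (hq.2.2.2.trans_lt hc)⟩
  have hgravity (q) (hq : q ∈ region) :=
    contDiffAt_gravityCoeff (κ := κ) (hpos q hq).2.1 (hpos q hq).2.2.ne'
  have hgravityCont : ContinuousOn (fun q : ℝ × ℝ => gravityCoeff lam mu κ q.1 q.2) region :=
    fun q hq => (hgravity q hq).continuousAt.continuousWithinAt
  obtain ⟨m, hm, hmle⟩ := hcompact.exists_forall_le' hgravityCont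
    fun q hq => gravityCoeff_pos hκ (hpos q hq).1 (hpos q hq).2.1 (hpos q hq).2.2
  obtain ⟨M, hM⟩ := (hcompact.image_of_continuousOn hgravityCont).bddAbove
  obtain ⟨LB, B, hLB, hBmem, hB⟩ := exists_lipschitz_extension hcompact
    (locallyLipschitzOn_of_contDiffAt fun q hq =>
      contDiffAt_shearCoeff (hpos q hq).2.1 (hpos q hq).2.2.ne')
    (by norm_num : (-1 / 2 : ℝ) ≤ 0)
    fun q hq => shearCoeff_mem hlam hmu' (hpos q hq).1 hq.2.1 (hq.2.2.2.trans_lt hc)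
  obtain ⟨LF, F, hLF, hFmem, hF⟩ := exists_lipschitz_extension hcompact
    (locallyLipschitzOn_of_contDiffAt hgravity) (le_max_left m M)
    fun q hq => ⟨hmle q hq, (hM (mem_image_of_mem _ hq)).trans (le_max_right _ _)⟩
  exact ⟨B, F, max LB LF, m, max m M,
    ⟨hBmem, fun q => ⟨hm.trans_le (hFmem q).1, (hFmem q).2⟩,
      hLB.weaken (le_max_left _ _), hLF.weaken (le_max_right _ _)⟩,
    hm, fun q => (hFmem q).1, hB, hF⟩

end Coefficients

section MeanDensity

variable {K R r C : ℝ} {ρ : ℝ → ℝ}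

lemma enclosedMass_eq_meanRelDensity (hK : K ≠ 0) (hr : r ≠ 0) :
    enclosedMass ρ r = 4 * Real.pi / 3 * K * meanRelDensity K ρ r * r ^ 3 := by
  unfold meanRelDensity
  field_simp

lemma mul_enclosedMass_div_sq (hK : K ≠ 0) (hr : r ≠ 0) :
    ρ r * (enclosedMass ρ r / r ^ 2) =
      4 * Real.pi / 3 * K ^ 2 * relDensity K ρ r * meanRelDensity K ρ r * r := by
  rw [enclosedMass_eq_meanRelDensity hK hr, relDensity]
  field_simp

lemma meanRelDensity_eq_powerMean (hr : r ≠ 0) :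
    meanRelDensity K ρ r = 3 / K * powerMean 2 ρ r := by
  have h := pow_succ_smul_powerMean 2 ρ r
  simp only [smul_eq_mul, mul_comm (_ ^ 2)] at h
  rw [meanRelDensity, enclosedMass, ← h]
  rcases eq_or_ne K 0 with rfl | hK
  · simp
  · field_simp
    ring

lemma tendsto_meanRelDensity (hR : 0 < R) (h : ContinuousOn ρ (Icc 0 R)) :
    Tendsto (meanRelDensity K ρ) (𝓝[>] 0) (𝓝 (ρ 0 / K)) := by
  have ht := tendsto_nhdsGT_of_continuousOn hR
    ((continuousOn_powerMean (n := 2) h).const_mul (3 / K))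
  have h0 : 3 / K * powerMean 2 ρ 0 = ρ 0 / K := by
    rw [powerMean_zero]; push_cast; ring
  rw [h0] at ht
  refine ht.congr' ?_
  filter_upwards [self_mem_nhdsWithin] with r hr
  exact (meanRelDensity_eq_powerMean (ne_of_gt hr)).symm

lemma hasDerivAt_enclosedMass (h : ContinuousOn ρ (Icc 0 R)) (hr : r ∈ Ioo 0 R) :
    HasDerivAt (enclosedMass ρ) (4 * Real.pi * (ρ r * r ^ 2)) r := by
  have hcont : ContinuousOn (fun s => ρ s * s ^ 2) (Icc 0 R) :=
    h.mul (continuous_pow 2).continuousOn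
  have hnhds : ∀ s ∈ Ioo 0 R, ContinuousAt (fun s => ρ s * s ^ 2) s := fun s hs =>
    hcont.continuousAt (Icc_mem_nhds hs.1 hs.2)
  refine (intervalIntegral.integral_hasDerivAt_right ?_ ?_ (hnhds r hr)).const_mul _
  · exact (hcont.mono (Icc_subset_Icc_right hr.2.le)).intervalIntegrable_of_Icc hr.1.le
  · exact ContinuousOn.stronglyMeasurableAtFilter isOpen_Ioo
      (fun s hs => (hnhds s hs).continuousWithinAt) r hr

lemma hasDerivAt_meanRelDensity (hK : K ≠ 0) (h : ContinuousOn ρ (Icc 0 R)) (hr : r ∈ Ioo 0 R) :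
    HasDerivAt (meanRelDensity K ρ) (3 * (relDensity K ρ r - meanRelDensity K ρ r) / r) r := by
  have hr0 : r ≠ 0 := hr.1.ne'
  refine ((hasDerivAt_enclosedMass h hr).div
    ((hasDerivAt_pow 3 r).const_mul (4 * Real.pi / 3 * K)) (by positivity)).congr_deriv ?_
  unfold relDensity meanRelDensity
  push_cast
  field_simp

lemma meanRelDensity_le (hK : 0 < K) (h : ContinuousOn ρ (Icc 0 r)) (hr : 0 < r)
    (hC : ∀ s ∈ Icc 0 r, ρ s ≤ C) : meanRelDensity K ρ r ≤ C / K := by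
  calc meanRelDensity K ρ r = 3 / K * powerMean 2 ρ r := meanRelDensity_eq_powerMean hr.ne'
    _ ≤ 3 / K * powerMean 2 (fun _ => C) r := by
        gcongr
        exact powerMean_mono hr.le h continuousOn_const hC
    _ = C / K := by rw [powerMean_const]; push_cast; ring

lemma le_meanRelDensity (hK : 0 < K) (h : ContinuousOn ρ (Icc 0 r)) (hr : 0 < r)
    (hC : ∀ s ∈ Icc 0 r, C ≤ ρ s) : C / K ≤ meanRelDensity K ρ r := by
  calc C / K = 3 / K * powerMean 2 (fun _ => C) r := by rw [powerMean_const]; push_cast; ring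
    _ ≤ 3 / K * powerMean 2 ρ r := by
        gcongr
        exact powerMean_mono hr.le continuousOn_const h hC
    _ = meanRelDensity K ρ r := (meanRelDensity_eq_powerMean hr.ne').symm

lemma meanRelDensity_pos (hK : 0 < K) (h : ContinuousOn ρ (Icc 0 r)) (hr : 0 < r)
    (hpos : ∀ s ∈ Ioo 0 r, 0 < ρ s) : 0 < meanRelDensity K ρ r := by
  rw [meanRelDensity_eq_powerMean hr.ne']
  exact mul_pos (by positivity) (powerMean_pos hr h hpos)

end MeanDensity

section CentralDensity

variable {α : Type*} {l : Filter α} {lam mu p c : ℝ} {δ η : α → ℝ}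

lemma tendsto_rpow_div_of_tendsto_radPressure (hmu : lam + mu ≠ 0) (hη : Tendsto η l (𝓝 0))
    (hη0 : ∀ᶠ x in l, 0 ≤ η x)
    (hrad : Tendsto (fun x => radPressure lam mu (δ x) (η x)) l (𝓝 p)) :
    Tendsto (fun x => η x ^ (2 / 3 : ℝ) / δ x) l
      (𝓝 ((lam + 2 * mu - p) / (2 * (lam + mu)))) := by
  have hu := hη.rpow_const (p := (2 / 3 : ℝ)) (Or.inr (by norm_num))
  rw [Real.zero_rpow (by norm_num)] at hu
  have hden := (hu.const_mul lam).const_sub (2 * (lam + mu))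
  rw [mul_zero, sub_zero] at hden
  have hne : 2 * (lam + mu) ≠ 0 := mul_ne_zero two_ne_zero hmu
  refine ((hrad.const_sub (lam + 2 * mu)).div hden hne).congr' ?_
  filter_upwards [hη0, hden.eventually_ne hne] with x hx hx'
  rw [Pi.div_apply, div_eq_iff hx', radPressure, radProfile, rpow_four_thirds hx]
  ring

lemma tendsto_rpow_mul_of_tendsto_tanPressure_sub (hmu : lam + mu ≠ 0) (hη : Tendsto η l (𝓝 0))
    (hη0 : ∀ᶠ x in l, 0 ≤ η x)
    (hsub : Tendsto (fun x => tanPressure lam mu (δ x) (η x) - radPressure lam mu (δ x) (η x)) l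
      (𝓝 0)) :
    Tendsto (fun x => η x ^ (2 / 3 : ℝ) * (1 / δ x - δ x / η x ^ 2)) l (𝓝 0) := by
  have hu := hη.rpow_const (p := (2 / 3 : ℝ)) (Or.inr (by norm_num))
  rw [Real.zero_rpow (by norm_num)] at hu
  have hden := (hu.const_mul lam).const_sub (lam + mu)
  rw [mul_zero, sub_zero] at hden
  rw [← zero_div (lam + mu)]
  refine (hsub.div hden hmu).congr' ?_
  filter_upwards [hη0, hden.eventually_ne hmu] with x hx hx'
  rw [Pi.div_apply, div_eq_iff hx', tanPressure, shearProfile_eq_mul hx]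
  ring

/-- If `η → 0` then, for `u = η ^ (2 / 3)`, both `u / δ` and `u δ / η²` converge, so that
`1 = u³ / η² = (u / δ) (u δ / η²) u` tends to `0`. -/
theorem ne_zero_of_tendsto_pressures [l.NeBot] (hmu : lam + mu ≠ 0)
    (hpos : ∀ᶠ x in l, 0 < δ x ∧ 0 < η x) (hη : Tendsto η l (𝓝 c))
    (hrad : Tendsto (fun x => radPressure lam mu (δ x) (η x)) l (𝓝 p))
    (htan : Tendsto (fun x => tanPressure lam mu (δ x) (η x)) l (𝓝 p)) : c ≠ 0 := by
  rintro rfl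
  have hη0 : ∀ᶠ x in l, 0 ≤ η x := hpos.mono fun _ h => h.2.le
  have hu := hη.rpow_const (p := (2 / 3 : ℝ)) (Or.inr (by norm_num))
  rw [Real.zero_rpow (by norm_num)] at hu
  have hfst := tendsto_rpow_div_of_tendsto_radPressure hmu hη hη0 hrad
  have hsnd := hfst.sub (tendsto_rpow_mul_of_tendsto_tanPressure_sub hmu hη hη0
    (by simpa only [sub_self] using htan.sub hrad))
  have hone : Tendsto (fun _ => (1 : ℝ)) l (𝓝 0) := by
    rw [← mul_zero (_ * _)]
    refine ((hfst.mul hsnd).mul hu).congr' ?_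
    filter_upwards [hpos] with x ⟨hδ, hη⟩
    calc η x ^ (2 / 3 : ℝ) / δ x * (η x ^ (2 / 3 : ℝ) / δ x
          - η x ^ (2 / 3 : ℝ) * (1 / δ x - δ x / η x ^ 2)) * η x ^ (2 / 3 : ℝ)
        = (η x ^ (2 / 3 : ℝ)) ^ 3 / η x ^ 2 := by field_simp; ring
      _ = 1 := by rw [rpow_two_thirds_pow_three hη.le, div_self (pow_pos hη 2).ne']
  exact one_ne_zero (tendsto_nhds_unique tendsto_const_nhds hone)

end CentralDensity

section RegularBall

/-- A regular static self-gravitating ball of the Hadamard material with reference density `K`. -/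
abbrev IsHadamardBall (lam mu K : ℝ) (ρ prad ptan : ℝ → ℝ) (R : ℝ) : Prop :=
  IsRegularElasticBall K (hadamardRad lam mu) (hadamardTan lam mu) ρ prad ptan R

variable {lam mu κ K R R₁ r d e δc : ℝ} {B F : ℝ × ℝ → ℝ} {ρ prad ptan : ℝ → ℝ}

lemma strictMonoOn_radPressure (hh : 0 < radProfile lam mu e) :
    StrictMonoOn (fun d => radPressure lam mu d e) (Ioi 0) := fun _ hd₁ _ _ hlt =>
  sub_lt_sub_left (div_lt_div_of_pos_left hh hd₁ hlt) _

lemma mem_admissibleRegion_of_radPressure_pos (hlam : 0 < lam) (hmu : 0 < lam + mu)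
    (hd : 0 < d) (hde : d ≤ e) (he : e ≤ δc) (hc : δc < criticalDensity lam mu)
    (hP : 0 < radPressure lam mu d e) : (d, e) ∈ admissibleRegion lam mu δc := by
  have he0 : 0 < e := hd.trans_le hde
  have hec : e < criticalDensity lam mu := he.trans_lt hc
  have hh := radProfile_pos hlam hmu he0 hec
  have hone : 1 < e := (radPressure_self_pos_iff hlam hmu he0).1
    (hP.trans_le ((strictMonoOn_radPressure hh).monotoneOn hd he0 hde))
  have hmin := lt_radProfile hlam hmu hone.le hec
  rw [radPressure, sub_pos, div_lt_iff₀ hd] at hP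
  have hlt : 0 < lam + 2 * mu := pos_of_mul_pos_left (hh.trans hP) hd.le
  exact ⟨(div_le_iff₀' hlt).2 (hmin.trans hP).le, hde, hone.le, he⟩

lemma density_rhs_nonpos (hκ : 0 ≤ κ) (hr : 0 < r) (hd : 0 < d) (he : 0 < e)
    (hg : 0 ≤ shearProfile lam mu e) (hh : 0 ≤ radProfile lam mu e) :
    -(shearCoeff lam mu d e * (d - e) / r) - r * gravityCoeff lam mu κ d e ≤ 0 := by
  have hshear : 0 ≤ shearCoeff lam mu d e * (d - e) / r := by
    rw [shearCoeff, div_mul_eq_mul_div, mul_assoc, ← sq]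
    positivity
  have hgravity : 0 ≤ r * gravityCoeff lam mu κ d e := by
    unfold gravityCoeff
    positivity
  linarith

lemma IsRegularBall.rho_pos (h : IsRegularBall ρ prad ptan R) (hr : r ∈ Ioo 0 R) : 0 < ρ r := by
  rw [← h.support] at hr
  exact (interior_subset hr).2

namespace IsHadamardBall

lemma mean_pos (h : IsHadamardBall lam mu K ρ prad ptan R) (hr : r ∈ Ioc 0 R) :
    0 < meanRelDensity K ρ r :=
  meanRelDensity_pos h.2.refDensity_pos (h.1.cont_rho.mono (Icc_subset_Icc_right hr.2)) hr.1
    fun _ hs => h.1.rho_pos ⟨hs.1, hs.2.trans_le hr.2⟩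

lemma relDensity_pos (h : IsHadamardBall lam mu K ρ prad ptan R) (hr : r ∈ Ioo 0 R) :
    0 < relDensity K ρ r :=
  div_pos (h.1.rho_pos hr) h.2.refDensity_pos

lemma prad_eq (h : IsHadamardBall lam mu K ρ prad ptan R) (hr : r ∈ Ioo 0 R) :
    prad r = radPressure lam mu (relDensity K ρ r) (meanRelDensity K ρ r) := by
  rw [h.2.rad_eq r hr.1 (h.1.rho_pos hr),
    hadamardRad_eq (h.relDensity_pos hr) (h.mean_pos (Ioo_subset_Ioc_self hr))]

lemma ptan_eq (h : IsHadamardBall lam mu K ρ prad ptan R) (hr : r ∈ Ioo 0 R) :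
    ptan r = tanPressure lam mu (relDensity K ρ r) (meanRelDensity K ρ r) := by
  rw [h.2.tan_eq r hr.1 (h.1.rho_pos hr),
    hadamardTan_eq (h.relDensity_pos hr) (h.mean_pos (Ioo_subset_Ioc_self hr))]

lemma tendsto_relDensity (h : IsHadamardBall lam mu K ρ prad ptan R) :
    Tendsto (relDensity K ρ) (𝓝[>] 0) (𝓝 (ρ 0 / K)) :=
  (tendsto_nhdsGT_of_continuousOn h.1.radius_pos h.1.cont_rho).div_const K

lemma tendsto_radPressure (h : IsHadamardBall lam mu K ρ prad ptan R) :
    Tendsto (fun r => radPressure lam mu (relDensity K ρ r) (meanRelDensity K ρ r)) (𝓝[>] 0)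
      (𝓝 (prad 0)) :=
  (tendsto_nhdsGT_of_continuousOn h.1.radius_pos h.1.cont_prad).congr'
    (eventually_of_mem (Ioo_mem_nhdsGT h.1.radius_pos) fun _ hr => h.prad_eq hr)

lemma tendsto_tanPressure (h : IsHadamardBall lam mu K ρ prad ptan R) :
    Tendsto (fun r => tanPressure lam mu (relDensity K ρ r) (meanRelDensity K ρ r)) (𝓝[>] 0)
      (𝓝 (prad 0)) :=
  h.1.isotropic_center ▸
    (tendsto_nhdsGT_of_continuousOn h.1.radius_pos h.1.cont_ptan).congr'
      (eventually_of_mem (Ioo_mem_nhdsGT h.1.radius_pos) fun _ hr => h.ptan_eq hr)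

lemma central_pos (hmu : lam + mu ≠ 0) (h : IsHadamardBall lam mu K ρ prad ptan R) :
    0 < ρ 0 / K := by
  have hmem : ∀ᶠ r in 𝓝[>] (0 : ℝ), r ∈ Ioo 0 R := Ioo_mem_nhdsGT h.1.radius_pos
  refine (ge_of_tendsto h.tendsto_relDensity
    (hmem.mono fun r hr => (h.relDensity_pos hr).le)).lt_of_ne' ?_
  exact ne_zero_of_tendsto_pressures hmu
    (hmem.mono fun r hr => ⟨h.relDensity_pos hr, h.mean_pos (Ioo_subset_Ioc_self hr)⟩)
    (tendsto_meanRelDensity h.1.radius_pos h.1.cont_rho) h.tendsto_radPressure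
    h.tendsto_tanPressure

theorem one_lt_central (hlam : 0 < lam) (hmu : 0 < lam + mu)
    (h : IsHadamardBall lam mu K ρ prad ptan R) : 1 < ρ 0 / K := by
  have hpos := h.central_pos hmu.ne'
  have hcont := (contDiffAt_radPressure (lam := lam) (mu := mu) (q := (ρ 0 / K, ρ 0 / K))
    hpos hpos).continuousAt.tendsto.comp (h.tendsto_relDensity.prodMk_nhds
      (tendsto_meanRelDensity h.1.radius_pos h.1.cont_rho))
  have hcenter : radPressure lam mu (ρ 0 / K) (ρ 0 / K) = prad 0 :=
    tendsto_nhds_unique hcont h.tendsto_radPressure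
  rw [← radPressure_self_pos_iff hlam hmu hpos, hcenter]
  exact h.1.prad_pos 0 ⟨le_rfl, h.1.radius_pos⟩

lemma hasDerivAt_relDensity (h : IsHadamardBall lam mu K ρ prad ptan R) (hr : r ∈ Ioo 0 R)
    (hh : 0 < radProfile lam mu (meanRelDensity K ρ r)) :
    HasDerivAt (relDensity K ρ)
      (-(shearCoeff lam mu (relDensity K ρ r) (meanRelDensity K ρ r)
          * (relDensity K ρ r - meanRelDensity K ρ r) / r)
        - r * gravityCoeff lam mu (4 * Real.pi / 3 * K ^ 2) (relDensity K ρ r)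
          (meanRelDensity K ρ r)) r := by
  have hK := h.2.refDensity_pos.ne'
  have hr0 : r ≠ 0 := hr.1.ne'
  have hδ := h.relDensity_pos hr
  have hη := h.mean_pos (Ioo_subset_Ioc_self hr)
  have hδ' : HasDerivAt (relDensity K ρ) (deriv (relDensity K ρ) r) r :=
    (((h.1.contDiff_rho.contDiffAt (Ioc_mem_nhds hr.1 hr.2)).differentiableAt
      one_ne_zero).div_const K).hasDerivAt
  have hchain := hasDerivAt_radPressure_comp (lam := lam) (mu := mu) hr0 hδ hη hδ'
    (hasDerivAt_meanRelDensity hK h.1.cont_rho hr)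
  have hequilibrium := (h.1.equilibrium r hr).congr_of_eventuallyEq
    (eventually_of_mem (Ioo_mem_nhds hr.1 hr.2) fun _ hs => (h.prad_eq hs).symm)
  have hunique := hchain.unique hequilibrium
  rw [h.prad_eq hr, h.ptan_eq hr, mul_enclosedMass_div_sq hK hr0,
    equilibrium_iff hr.1 hδ hη hh] at hunique
  exact hunique ▸ hδ'

lemma antitoneOn_relDensity (hlam : 0 < lam) (hmu : 0 < lam + mu)
    (h : IsHadamardBall lam mu K ρ prad ptan R) (hR₁ : R₁ ≤ R)
    (hc : ∀ r ∈ Ioo 0 R₁, meanRelDensity K ρ r < criticalDensity lam mu) :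
    AntitoneOn (relDensity K ρ) (Icc 0 R₁) := by
  have hder (r) (hr : r ∈ Ioo 0 R₁) :
      ∃ δ' ≤ 0, HasDerivAt (relDensity K ρ) δ' r := by
    have hr' : r ∈ Ioo 0 R := ⟨hr.1, hr.2.trans_le hR₁⟩
    have hη := h.mean_pos (Ioo_subset_Ioc_self hr')
    have hh := radProfile_pos hlam hmu hη (hc r hr)
    exact ⟨_, density_rhs_nonpos (by positivity) hr.1 (h.relDensity_pos hr') hη
      (shearProfile_pos hlam hmu hη (hc r hr)).le hh.le, h.hasDerivAt_relDensity hr' hh⟩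
  refine antitoneOn_of_deriv_nonpos (convex_Icc 0 R₁)
    ((h.1.cont_rho.mono (Icc_subset_Icc_right hR₁)).div_const K) ?_ ?_
  all_goals
    rw [interior_Icc]
    intro r hr
    obtain ⟨δ', hδ', hd⟩ := hder r hr
  · exact hd.differentiableAt.differentiableWithinAt
  · rwa [hd.deriv]

lemma mean_le_central (h : IsHadamardBall lam mu K ρ prad ptan R) (hr : r ∈ Ioc 0 R)
    (hanti : AntitoneOn (relDensity K ρ) (Icc 0 r)) : meanRelDensity K ρ r ≤ ρ 0 / K :=
  meanRelDensity_le h.2.refDensity_pos (h.1.cont_rho.mono (Icc_subset_Icc_right hr.2)) hr.1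
    fun _ hs => (div_le_div_iff_of_pos_right h.2.refDensity_pos).1
      (hanti ⟨le_rfl, hr.1.le⟩ hs hs.1)

lemma relDensity_le_mean (h : IsHadamardBall lam mu K ρ prad ptan R) (hr : r ∈ Ioc 0 R)
    (hanti : AntitoneOn (relDensity K ρ) (Icc 0 r)) : relDensity K ρ r ≤ meanRelDensity K ρ r :=
  le_meanRelDensity h.2.refDensity_pos (h.1.cont_rho.mono (Icc_subset_Icc_right hr.2)) hr.1
    fun _ hs => (div_le_div_iff_of_pos_right h.2.refDensity_pos).1
      (hanti hs ⟨hr.1.le, le_rfl⟩ hs.2)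

/-- As long as `η` stays below the critical value, `δ` decreases, so that `η ≤ δ(0)`: the
critical value is never reached. -/
lemma mean_lt_critical (hlam : 0 < lam) (hmu : 0 < lam + mu)
    (h : IsHadamardBall lam mu K ρ prad ptan R) (hcrit : ρ 0 / K < criticalDensity lam mu)
    (hr : r ∈ Ioc 0 R) : meanRelDensity K ρ r < criticalDensity lam mu := by
  by_contra! hbad
  have hcont : ContinuousOn (fun s => 3 / K * powerMean 2 ρ s) (Icc 0 r) :=
    (continuousOn_powerMean (h.1.cont_rho.mono (Icc_subset_Icc_right hr.2))).const_mul _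
  have hzero : 3 / K * powerMean 2 ρ 0 = ρ 0 / K := by rw [powerMean_zero]; push_cast; ring
  obtain ⟨s, hs, hsc, hlt⟩ := exists_first_eq_of_continuousOn hr.1.le hcont (hzero ▸ hcrit)
    (meanRelDensity_eq_powerMean hr.1.ne' ▸ hbad)
  have hsR : s ∈ Ioc 0 R := ⟨hs.1, hs.2.trans hr.2⟩
  have hanti := h.antitoneOn_relDensity hlam hmu hsR.2 fun t ht =>
    meanRelDensity_eq_powerMean ht.1.ne' ▸ hlt t (Ioo_subset_Ico_self ht)
  refine ((h.mean_le_central hsR hanti).trans_lt hcrit).ne ?_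
  rw [meanRelDensity_eq_powerMean hs.1.ne', hsc]

theorem isRadialFlow (hlam : 0 < lam) (hmu : 0 < lam + mu)
    (h : IsHadamardBall lam mu K ρ prad ptan R) (hcrit : ρ 0 / K < criticalDensity lam mu)
    (hB : EqOn B (fun q => shearCoeff lam mu q.1 q.2) (admissibleRegion lam mu (ρ 0 / K)))
    (hF : EqOn F (fun q => gravityCoeff lam mu (4 * Real.pi / 3 * K ^ 2) q.1 q.2)
      (admissibleRegion lam mu (ρ 0 / K))) :
    IsRadialFlow B F (ρ 0 / K) R (relDensity K ρ) (meanRelDensity K ρ) := by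
  have hlt (r) (hr : r ∈ Ioo 0 R) := h.mean_lt_critical hlam hmu hcrit (Ioo_subset_Ioc_self hr)
  have hanti (r) (hr : r ∈ Ioo 0 R) : AntitoneOn (relDensity K ρ) (Icc 0 r) :=
    (h.antitoneOn_relDensity hlam hmu le_rfl hlt).mono (Icc_subset_Icc_right hr.2.le)
  have hle (r) (hr : r ∈ Ioo 0 R) := h.relDensity_le_mean (Ioo_subset_Ioc_self hr) (hanti r hr)
  refine ⟨fun r hr => hasDerivAt_meanRelDensity h.2.refDensity_pos.ne' h.1.cont_rho hr,
    fun r hr => ?_, hle, h.tendsto_relDensity,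
    tendsto_meanRelDensity h.1.radius_pos h.1.cont_rho⟩
  have hmem := mem_admissibleRegion_of_radPressure_pos hlam hmu (h.relDensity_pos hr) (hle r hr)
    (h.mean_le_central (Ioo_subset_Ioc_self hr) (hanti r hr)) hcrit
    (h.prad_eq hr ▸ h.1.prad_pos r (Ioo_subset_Ico_self hr))
  rw [hB hmem, hF hmem]
  exact h.hasDerivAt_relDensity hr
    (radProfile_pos hlam hmu (h.mean_pos (Ioo_subset_Ioc_self hr)) (hlt r hr))

end IsHadamardBall

end RegularBall

section Uniqueness

variable {lam mu K R₁ R₂ : ℝ} {ρ₁ prad₁ ptan₁ ρ₂ prad₂ ptan₂ : ℝ → ℝ}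

namespace IsHadamardBall

lemma eqOn_relDensity_mean (hlam : 0 < lam) (hmu : 0 < lam + mu)
    (h₁ : IsHadamardBall lam mu K ρ₁ prad₁ ptan₁ R₁)
    (h₂ : IsHadamardBall lam mu K ρ₂ prad₂ ptan₂ R₂) (h0 : ρ₁ 0 = ρ₂ 0)
    (hcrit : ρ₂ 0 / K < criticalDensity lam mu) (hR : R₂ ≤ R₁) :
    ∀ r ∈ Ioo 0 R₂, relDensity K ρ₁ r = relDensity K ρ₂ r ∧
      meanRelDensity K ρ₁ r = meanRelDensity K ρ₂ r := by
  have hmu' : 0 < mu := (one_lt_criticalDensity_iff hlam hmu).1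
    ((h₂.one_lt_central hlam hmu).trans hcrit)
  have hK := h₂.2.refDensity_pos
  obtain ⟨B, F, L, m, M, hBF, -, -, hB, hF⟩ :=
    exists_isTameSystem (κ := 4 * Real.pi / 3 * K ^ 2) hlam
      (by linarith) (by positivity) hcrit
  have hflow₂ := h₂.isRadialFlow hlam hmu hcrit hB hF
  rw [← h0] at hcrit hB hF hflow₂
  exact ((h₁.isRadialFlow hlam hmu hcrit hB hF).mono hR).eqOn hBF hflow₂

lemma eqOn_Icc (hlam : 0 < lam) (hmu : 0 < lam + mu)
    (h₁ : IsHadamardBall lam mu K ρ₁ prad₁ ptan₁ R₁)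
    (h₂ : IsHadamardBall lam mu K ρ₂ prad₂ ptan₂ R₂) (h0 : ρ₁ 0 = ρ₂ 0)
    (hcrit : ρ₂ 0 / K < criticalDensity lam mu) (hR : R₂ ≤ R₁) :
    EqOn ρ₁ ρ₂ (Icc 0 R₂) ∧ EqOn prad₁ prad₂ (Icc 0 R₂) ∧ EqOn ptan₁ ptan₂ (Icc 0 R₂) := by
  have heq := h₁.eqOn_relDensity_mean hlam hmu h₂ h0 hcrit hR
  have hmem (r) (hr : r ∈ Ioo 0 R₂) : r ∈ Ioo 0 R₁ := ⟨hr.1, hr.2.trans_le hR⟩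
  have hextend {f g : ℝ → ℝ} (hf : ContinuousOn f (Icc 0 R₁)) (hg : ContinuousOn g (Icc 0 R₂))
      (hfg : EqOn f g (Ioo 0 R₂)) : EqOn f g (Icc 0 R₂) :=
    hfg.of_subset_closure (hf.mono (Icc_subset_Icc_right hR)) hg Ioo_subset_Icc_self
      (closure_Ioo h₂.1.radius_pos.ne).ge
  refine ⟨hextend h₁.1.cont_rho h₂.1.cont_rho fun r hr =>
      (div_left_inj' h₂.2.refDensity_pos.ne').1 (heq r hr).1,
    hextend h₁.1.cont_prad h₂.1.cont_prad fun r hr => ?_,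
    hextend h₁.1.cont_ptan h₂.1.cont_ptan fun r hr => ?_⟩
  · rw [h₁.prad_eq (hmem r hr), h₂.prad_eq hr, (heq r hr).1, (heq r hr).2]
  · rw [h₁.ptan_eq (hmem r hr), h₂.ptan_eq hr, (heq r hr).1, (heq r hr).2]

lemma radius_le (hlam : 0 < lam) (hmu : 0 < lam + mu)
    (h₁ : IsHadamardBall lam mu K ρ₁ prad₁ ptan₁ R₁)
    (h₂ : IsHadamardBall lam mu K ρ₂ prad₂ ptan₂ R₂) (h0 : ρ₁ 0 = ρ₂ 0)
    (hcrit : ρ₂ 0 / K < criticalDensity lam mu) : R₁ ≤ R₂ := by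
  by_contra! hlt
  have hR₂ := h₂.1.radius_pos.le
  have hprad := (h₁.eqOn_Icc hlam hmu h₂ h0 hcrit hlt.le).2.1 ⟨hR₂, le_rfl⟩
  exact (h₁.1.prad_pos R₂ ⟨hR₂, hlt⟩).ne' (hprad.trans h₂.1.prad_boundary)

theorem unique (hlam : 0 < lam) (hmu : 0 < lam + mu)
    (h₁ : IsHadamardBall lam mu K ρ₁ prad₁ ptan₁ R₁)
    (h₂ : IsHadamardBall lam mu K ρ₂ prad₂ ptan₂ R₂) (h0 : ρ₁ 0 = ρ₂ 0)
    (hcrit : ρ₂ 0 / K < criticalDensity lam mu) :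
    R₁ = R₂ ∧ EqOn ρ₁ ρ₂ (Ici 0) ∧ EqOn prad₁ prad₂ (Ici 0) ∧ EqOn ptan₁ ptan₂ (Ici 0) := by
  obtain rfl : R₁ = R₂ := le_antisymm (h₁.radius_le hlam hmu h₂ h0 hcrit)
    (h₂.radius_le hlam hmu h₁ h0.symm (h0 ▸ hcrit))
  have hglue {f g : ℝ → ℝ} (hfg : EqOn f g (Icc 0 R₁)) (hf : ∀ r, R₁ < r → f r = 0)
      (hg : ∀ r, R₁ < r → g r = 0) : EqOn f g (Ici 0) := fun r hr => by
    rcases le_or_gt r R₁ with hle | hgt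
    · exact hfg ⟨hr, hle⟩
    · rw [hf r hgt, hg r hgt]
  obtain ⟨hρ, hrad, htan⟩ := h₁.eqOn_Icc hlam hmu h₂ h0 hcrit le_rfl
  exact ⟨rfl, hglue hρ h₁.1.rho_vacuum h₂.1.rho_vacuum,
    hglue hrad h₁.1.prad_vacuum h₂.1.prad_vacuum, hglue htan h₁.1.ptan_vacuum h₂.1.ptan_vacuum⟩

end IsHadamardBall

end Uniqueness

section BallProfile

/-- The compressions `(δ, η)` inside a ball of central compression `δc` and radius `R`, which is
the first zero of the radial pressure; here `κ = 4π / 3 * K²`. -/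
structure IsBallProfile (lam mu κ δc R : ℝ) (δ η : ℝ → ℝ) : Prop where
  radius_pos : 0 < R
  density_zero : δ 0 = δc
  mean_zero : η 0 = δc
  contDiffOn_density : ContDiffOn ℝ 1 δ (Icc 0 R)
  contDiffOn_mean : ContDiffOn ℝ 1 η (Icc 0 R)
  hasDerivAt_density_zero : HasDerivAt δ 0 0
  hasDerivAt_mean_zero : HasDerivAt η 0 0
  hasDerivAt_density : ∀ r ∈ Ioo 0 R,
    HasDerivAt δ (-(shearCoeff lam mu (δ r) (η r) * (δ r - η r) / r)
      - r * gravityCoeff lam mu κ (δ r) (η r)) r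
  hasDerivAt_mean : ∀ r ∈ Ioo 0 R, HasDerivAt η (3 * (δ r - η r) / r) r
  density_pos : ∀ r ∈ Icc 0 R, 0 < δ r
  density_lt_mean : ∀ r ∈ Ioc 0 R, δ r < η r
  mean_lt : ∀ r ∈ Ioc 0 R, η r < δc
  pressure_pos : ∀ r ∈ Ico 0 R, 0 < radPressure lam mu (δ r) (η r)
  pressure_boundary : radPressure lam mu (δ R) (η R) = 0

variable {lam mu κ δc m M R T r d e : ℝ} {δ η v : ℝ → ℝ} {B F : ℝ × ℝ → ℝ} {L : NNReal}

lemma strictAntiOn_meanOf (hv : Continuous v) (hneg : ∀ r ∈ Ioc 0 T, v r < 0) :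
    StrictAntiOn (meanOf δc v) (Icc 0 T) := by
  refine strictAntiOn_of_deriv_neg (convex_Icc 0 T) (continuous_meanOf hv).continuousOn ?_
  rw [interior_Icc]
  intro r hr
  rw [(hasDerivAt_meanOf hv r).deriv]
  exact mul_neg_of_pos_of_neg three_pos
    (mul_neg_of_pos_of_neg hr.1 (hneg r (Ioo_subset_Ioc_self hr)))

lemma hasDerivAt_densityOf_zero (hv : Continuous v) : HasDerivAt (densityOf δc v) 0 0 := by
  have hO : (fun r => r ^ 2 * v r) =O[𝓝 0] fun r => ‖r - 0‖ ^ 2 := by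
    simpa using ((Asymptotics.isBigO_refl (fun r : ℝ => r ^ 2) (𝓝 0)).mul
      ((hv.tendsto 0).isBigO_one ℝ))
  have hquad : HasDerivAt (fun r => r ^ 2 * v r) 0 0 := by
    simpa using (hO.hasFDerivAt one_lt_two).hasDerivAt
  exact ((hasDerivAt_meanOf hv 0).add hquad).congr_deriv (by simp)

lemma IsRadialFlow.hasDerivAt_densityOf (hv : Continuous v)
    (h : IsRadialFlow B F δc T (densityOf δc v) (meanOf δc v)) (hr : r ∈ Ico 0 T) :
    HasDerivAt (densityOf δc v) (-(r * (B (densityOf δc v r, meanOf δc v r) * v r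
      + F (densityOf δc v r, meanOf δc v r)))) r := by
  rcases hr.1.eq_or_lt with rfl | hr0
  · simpa using hasDerivAt_densityOf_zero hv
  · refine (h.hasDerivAt_density r ⟨hr0, hr.2⟩).congr_deriv ?_
    rw [show densityOf δc v r - meanOf δc v r = r ^ 2 * v r by rw [densityOf]; ring]
    field_simp
    ring

lemma contDiffOn_meanOf (hR : 0 < R) (hv : Continuous v) :
    ContDiffOn ℝ 1 (meanOf δc v) (Icc 0 R) :=
  contDiffOn_one_of_hasDerivAt hR (fun r _ => hasDerivAt_meanOf hv r) (by fun_prop)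

lemma IsRadialFlow.contDiffOn_densityOf (hBF : IsTameSystem B F L M) (hv : Continuous v)
    (h : IsRadialFlow B F δc T (densityOf δc v) (meanOf δc v)) (hR : R ∈ Ioo 0 T) :
    ContDiffOn ℝ 1 (densityOf δc v) (Icc 0 R) := by
  have hB := hBF.lipschitz_shear.continuous
  have hF := hBF.lipschitz_gravity.continuous
  have hδ := continuous_densityOf (δc := δc) hv
  have hη := continuous_meanOf (δc := δc) hv
  exact contDiffOn_one_of_hasDerivAt hR.1
    (fun r hr => h.hasDerivAt_densityOf hv ⟨hr.1, hr.2.trans_lt hR.2⟩)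
    (by fun_prop)

lemma IsRadialFlow.density_add_sq_le (h : IsRadialFlow B F δc T δ η) (hT : 0 ≤ T)
    (hδ : ContinuousOn δ (Icc 0 T)) (hB : ∀ q, B q ≤ 0) (hF : ∀ q, m ≤ F q) :
    δ T + m / 2 * T ^ 2 ≤ δ 0 := by
  have hderiv (r) (hr : r ∈ Ioo 0 T) :=
    (h.hasDerivAt_density r hr).add ((hasDerivAt_pow 2 r).const_mul (m / 2))
  have hanti : AntitoneOn (fun r => δ r + m / 2 * r ^ 2) (Icc 0 T) := by
    refine antitoneOn_of_hasDerivWithinAt_nonpos (convex_Icc 0 T)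
      (hδ.add (by fun_prop)) (fun r hr => (hderiv r ?_).hasDerivWithinAt) fun r hr => ?_
    · rwa [interior_Icc] at hr
    · rw [interior_Icc] at hr
      have hshear : 0 ≤ B (δ r, η r) * (δ r - η r) / r :=
        div_nonneg (mul_nonneg_of_nonpos_of_nonpos (hB _)
          (sub_nonpos.2 (h.density_le_mean r hr))) hr.1.le
      have hgravity : r * m ≤ r * F (δ r, η r) := mul_le_mul_of_nonneg_left (hF _) hr.1.le
      norm_num
      linarith
  simpa using hanti ⟨le_rfl, hT⟩ ⟨hT, le_rfl⟩ hT

lemma pos_and_one_le_of_radProfile_le (hlam : 0 < lam) (hmu : 0 < mu) (hde : d ≤ e)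
    (he : max 1 e < criticalDensity lam mu)
    (hP : radProfile lam mu (max 1 e) ≤ (lam + 2 * mu) * d) : 0 < d ∧ 1 ≤ e := by
  have hmu' : 0 < lam + mu := by positivity
  have hpos : 0 < lam + 2 * mu := by positivity
  have hprofile := lt_radProfile hlam hmu' (le_max_left 1 e) he
  refine ⟨pos_of_mul_pos_right ((hmu'.trans hprofile).trans_le hP) hpos.le, ?_⟩
  by_contra! hlt
  have hone : lam + 2 * mu ≤ radProfile lam mu 1 := by
    have := (radPressure_self_pos_iff hlam hmu' one_pos).not.2 (lt_irrefl 1)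
    rwa [radPressure, div_one, sub_pos, not_lt] at this
  rw [max_eq_left hlt.le] at hP
  exact (hde.trans_lt hlt).not_ge
    ((mul_le_mul_iff_of_pos_left hpos).1 (by rw [mul_one]; exact hone.trans hP))

/-- Past the boundary nothing is known about `η`; replacing it by `max 1 η` keeps the profile above
`lam + mu`. -/
lemma exists_first_radProfile_eq (hlam : 0 < lam) (hmu : 0 < mu) (hT : 0 ≤ T) (h1 : 1 < δc)
    (hc : δc < criticalDensity lam mu) (hδ : ContinuousOn δ (Icc 0 T))
    (hη : ContinuousOn η (Icc 0 T)) (hδ0 : δ 0 = δc) (hη0 : η 0 = δc) (hηT : η T ≤ δc)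
    (hδT : δ T < 0) :
    ∃ R ∈ Ioo 0 T, radProfile lam mu (max 1 (η R)) = (lam + 2 * mu) * δ R ∧
      ∀ r ∈ Ico 0 R, radProfile lam mu (max 1 (η r)) < (lam + 2 * mu) * δ r := by
  have hmu' : 0 < lam + mu := by positivity
  set N : ℝ → ℝ := fun r => radProfile lam mu (max 1 (η r)) - (lam + 2 * mu) * δ r
  have hmax : ContinuousOn (fun r => max 1 (η r)) (Icc 0 T) := continuousOn_const.sup hη
  have hN : ContinuousOn N (Icc 0 T) := fun r hr =>
    (ContinuousAt.comp_continuousWithinAt (f := fun r => max 1 (η r))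
      (contDiffAt_radProfile (lt_max_of_lt_left one_pos)).continuousAt (hmax r hr)).sub
      ((hδ r hr).const_mul _)
  have hN0 : N 0 < 0 := by
    have := (radPressure_self_pos_iff hlam hmu' (one_pos.trans h1)).2 h1
    rw [radPressure, sub_pos, div_lt_iff₀ (one_pos.trans h1)] at this
    simp only [N, hδ0, hη0, max_eq_right h1.le]
    linarith
  have hNT : 0 < N T := by
    have hprofile := lt_radProfile hlam hmu' (le_max_left 1 (η T)) ((max_le h1.le hηT).trans_lt hc)
    have : (lam + 2 * mu) * δ T < 0 := mul_neg_of_pos_of_neg (by positivity) hδT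
    simp only [N]
    linarith
  obtain ⟨R, hR, hNR, hNneg⟩ := exists_first_eq_of_continuousOn hT hN hN0 hNT.le
  exact ⟨R, ⟨hR.1, hR.2.lt_of_ne (by rintro rfl; exact hNT.ne' hNR)⟩, sub_eq_zero.1 hNR,
    fun r hr => sub_neg.1 (hNneg r hr)⟩

lemma exists_first_zero_radPressure (hlam : 0 < lam) (hmu : 0 < mu) (hT : 0 ≤ T) (h1 : 1 < δc)
    (hc : δc < criticalDensity lam mu) (hδ : ContinuousOn δ (Icc 0 T))
    (hη : ContinuousOn η (Icc 0 T)) (hδ0 : δ 0 = δc) (hη0 : η 0 = δc)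
    (hle : ∀ r ∈ Icc 0 T, δ r ≤ η r ∧ η r ≤ δc) (hδT : δ T < 0) :
    ∃ R ∈ Ioo 0 T, (∀ r ∈ Icc 0 R, 0 < δ r) ∧
      (∀ r ∈ Ico 0 R, 0 < radPressure lam mu (δ r) (η r)) ∧
      radPressure lam mu (δ R) (η R) = 0 := by
  obtain ⟨R, hR, heq, hlt⟩ :=
    exists_first_radProfile_eq hlam hmu hT h1 hc hδ hη hδ0 hη0 (hle T ⟨hT, le_rfl⟩).2 hδT
  have hin (r) (hr : r ∈ Icc 0 R) : 0 < δ r ∧ 1 ≤ η r := by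
    have hr' := hle r (Icc_subset_Icc_right hR.2.le hr)
    refine pos_and_one_le_of_radProfile_le hlam hmu hr'.1 ((max_le h1.le hr'.2).trans_lt hc) ?_
    rcases hr.2.lt_or_eq with h | rfl
    exacts [(hlt r ⟨hr.1, h⟩).le, heq.le]
  refine ⟨R, hR, fun r hr => (hin r hr).1, fun r hr => ?_, ?_⟩
  · obtain ⟨hδr, hηr⟩ := hin r (Ico_subset_Icc_self hr)
    rw [radPressure, sub_pos, div_lt_iff₀ hδr, ← max_eq_right hηr]
    exact hlt r hr
  · obtain ⟨hδR, hηR⟩ := hin R ⟨hR.1.le, le_rfl⟩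
    rw [radPressure, sub_eq_zero, eq_div_iff hδR.ne', ← heq, max_eq_right hηR]

lemma densityOf_lt_meanOf (hr : r ≠ 0) (hv : v r < 0) : densityOf δc v r < meanOf δc v r :=
  add_lt_of_neg_right _ (mul_neg_of_pos_of_neg (by positivity) hv)

lemma meanOf_lt (hv : Continuous v) (hneg : ∀ r ∈ Ioc 0 T, v r < 0) (hr : r ∈ Ioc 0 T) :
    meanOf δc v r < δc := by
  simpa only [meanOf_zero] using strictAntiOn_meanOf (δc := δc) hv hneg
    ⟨le_rfl, hr.1.le.trans hr.2⟩ (Ioc_subset_Icc_self hr) hr.1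

lemma IsRadialFlow.isBallProfile (hlam : 0 < lam) (hmu : 0 < lam + mu)
    (hc : δc < criticalDensity lam mu) (hBF : IsTameSystem B F L M)
    (hB : EqOn B (fun q => shearCoeff lam mu q.1 q.2) (admissibleRegion lam mu δc))
    (hF : EqOn F (fun q => gravityCoeff lam mu κ q.1 q.2) (admissibleRegion lam mu δc))
    (hv : Continuous v) (hneg : ∀ r ∈ Ioc 0 T, v r < 0)
    (h : IsRadialFlow B F δc T (densityOf δc v) (meanOf δc v)) (hR : R ∈ Ioo 0 T)
    (hpos : ∀ r ∈ Icc 0 R, 0 < densityOf δc v r)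
    (hP : ∀ r ∈ Ico 0 R, 0 < radPressure lam mu (densityOf δc v r) (meanOf δc v r))
    (hPR : radPressure lam mu (densityOf δc v R) (meanOf δc v R) = 0) :
    IsBallProfile lam mu κ δc R (densityOf δc v) (meanOf δc v) where
  radius_pos := hR.1
  density_zero := densityOf_zero δc v
  mean_zero := meanOf_zero δc v
  contDiffOn_density := h.contDiffOn_densityOf hBF hv hR
  contDiffOn_mean := contDiffOn_meanOf hR.1 hv
  hasDerivAt_density_zero := hasDerivAt_densityOf_zero hv
  hasDerivAt_mean_zero := (hasDerivAt_meanOf hv 0).congr_deriv (by simp)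
  hasDerivAt_density r hr := by
    have hrT : r ∈ Ioc 0 T := ⟨hr.1, (hr.2.trans hR.2).le⟩
    have hmem := mem_admissibleRegion_of_radPressure_pos hlam hmu
      (hpos r (Ioo_subset_Icc_self hr)) (densityOf_lt_meanOf hr.1.ne' (hneg r hrT)).le
      (meanOf_lt hv hneg hrT).le hc (hP r (Ioo_subset_Ico_self hr))
    have hderiv := h.hasDerivAt_density r ⟨hr.1, hr.2.trans hR.2⟩
    rwa [hB hmem, hF hmem] at hderiv
  hasDerivAt_mean r hr := h.hasDerivAt_mean r ⟨hr.1, hr.2.trans hR.2⟩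
  density_pos := hpos
  density_lt_mean r hr := densityOf_lt_meanOf hr.1.ne' (hneg r ⟨hr.1, hr.2.trans hR.2.le⟩)
  mean_lt r hr := meanOf_lt hv hneg ⟨hr.1, hr.2.trans hR.2.le⟩
  pressure_pos := hP
  pressure_boundary := hPR

/-- A uniform lower bound on the gravity term forces `δ` to vanish in finite radius, after the
radial pressure does. -/
theorem exists_isBallProfile (hlam : 0 < lam) (hmu : 0 < mu) (hκ : 0 < κ) (h1 : 1 < δc)
    (hc : δc < criticalDensity lam mu) :
    ∃ (R : ℝ) (δ η : ℝ → ℝ), IsBallProfile lam mu κ δc R δ η := by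
  obtain ⟨B, F, L, m, M, hBF, hm, hmF, hB, hF⟩ :=
    exists_isTameSystem hlam (by positivity) hκ hc
  have : 0 < δc := one_pos.trans h1
  set T := 2 * δc / m + 1
  have hT : 0 < T := by positivity
  have hmT : δc < m / 2 * T ^ 2 := by
    have hT1 : T ≤ T ^ 2 := le_self_pow₀ (le_add_of_nonneg_left (by positivity)) two_ne_zero
    calc δc < m / 2 * T := by simp only [T]; field_simp; linarith
      _ ≤ m / 2 * T ^ 2 := mul_le_mul_of_nonneg_left hT1 (by positivity)
  obtain ⟨v, hv, hneg, hflow⟩ := hBF.exists_isRadialFlow hT.le δc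
  have hδ := (continuous_densityOf (δc := δc) hv).continuousOn (s := Icc 0 T)
  have hδT : densityOf δc v T < 0 := by
    have hdecay := hflow.density_add_sq_le hT.le hδ (fun q => (hBF.shear_mem q).2) hmF
    rw [densityOf_zero] at hdecay
    linarith
  have hle (r) (hr : r ∈ Icc 0 T) : densityOf δc v r ≤ meanOf δc v r ∧ meanOf δc v r ≤ δc := by
    rcases hr.1.eq_or_lt with rfl | hr0
    · rw [densityOf_zero, meanOf_zero]
      exact ⟨le_rfl, le_rfl⟩
    · exact ⟨(densityOf_lt_meanOf hr0.ne' (hneg r ⟨hr0, hr.2⟩)).le,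
        (meanOf_lt hv hneg ⟨hr0, hr.2⟩).le⟩
  obtain ⟨R, hR, hpos, hP, hPR⟩ := exists_first_zero_radPressure hlam hmu hT.le h1 hc hδ
    (continuous_meanOf hv).continuousOn (densityOf_zero δc v) (meanOf_zero δc v) hle hδT
  exact ⟨R, _, _, hflow.isBallProfile hlam (by positivity) hc hBF hB hF hv hneg hR hpos hP hPR⟩

namespace IsBallProfile

lemma mean_pos (h : IsBallProfile lam mu κ δc R δ η) (hr : r ∈ Icc 0 R) : 0 < η r := by
  rcases hr.1.eq_or_lt with rfl | hr0
  · rw [h.mean_zero, ← h.density_zero]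
    exact h.density_pos 0 hr
  · exact (h.density_pos r hr).trans (h.density_lt_mean r ⟨hr0, hr.2⟩)

lemma one_lt_mean (hlam : 0 < lam) (hmu : 0 < lam + mu) (hc : δc < criticalDensity lam mu)
    (h : IsBallProfile lam mu κ δc R δ η) (hr : r ∈ Ioc 0 R) : 1 < η r := by
  have hr' := Ioc_subset_Icc_self hr
  have hη := h.mean_pos hr'
  have hP : 0 ≤ radPressure lam mu (δ r) (η r) := by
    rcases hr.2.lt_or_eq with hlt | rfl
    exacts [(h.pressure_pos r ⟨hr.1.le, hlt⟩).le, h.pressure_boundary.ge]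
  refine (radPressure_self_pos_iff hlam hmu hη).1 (hP.trans_lt ?_)
  exact strictMonoOn_radPressure (radProfile_pos hlam hmu hη ((h.mean_lt r hr).trans hc))
    (h.density_pos r hr') hη (h.density_lt_mean r hr)

end IsBallProfile

end BallProfile

section BallField

/-- The quantity `Q(δ, η)` inside the ball of radius `R`, set to zero outside. -/
def ballField (R : ℝ) (δ η : ℝ → ℝ) (Q : ℝ → ℝ → ℝ) (r : ℝ) : ℝ :=
  if r ≤ R then Q (δ r) (η r) else 0

/-- The mass density of the ball with compressions `(δ, η)` and reference density `K`. -/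
abbrev ballDensity (K R : ℝ) (δ η : ℝ → ℝ) : ℝ → ℝ := ballField R δ η fun d _ => K * d

variable {lam mu κ δc K R r d e : ℝ} {δ η : ℝ → ℝ} {Q : ℝ → ℝ → ℝ}

lemma ballField_of_le (hr : r ≤ R) : ballField R δ η Q r = Q (δ r) (η r) := if_pos hr

lemma ballField_of_lt (hr : R < r) : ballField R δ η Q r = 0 := if_neg hr.not_ge

lemma ballDensity_of_le (hr : r ≤ R) : ballDensity K R δ η r = K * δ r := if_pos hr

lemma relDensity_ballDensity (hK : K ≠ 0) (hr : r ≤ R) :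
    relDensity K (ballDensity K R δ η) r = δ r := by
  rw [relDensity, ballDensity_of_le hr, mul_div_cancel_left₀ _ hK]

lemma radPressure_le_tanPressure (hd : 0 < d) (hde : d ≤ e) (hg : 0 ≤ shearProfile lam mu e) :
    radPressure lam mu d e ≤ tanPressure lam mu d e := by
  have he := hd.trans_le hde
  refine le_add_of_nonneg_right (mul_nonneg hg (sub_nonneg.2 ?_))
  rw [div_le_div_iff₀ (by positivity) hd, ← pow_two, one_mul]
  exact pow_le_pow_left₀ hd.le hde 2

namespace IsBallProfile

lemma density_le_mean (h : IsBallProfile lam mu κ δc R δ η) (hr : r ∈ Icc 0 R) : δ r ≤ η r := by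
  rcases hr.1.eq_or_lt with rfl | hr0
  · rw [h.density_zero, h.mean_zero]
  · exact (h.density_lt_mean r ⟨hr0, hr.2⟩).le

lemma mean_le (h : IsBallProfile lam mu κ δc R δ η) (hr : r ∈ Icc 0 R) : η r ≤ δc := by
  rcases hr.1.eq_or_lt with rfl | hr0
  · exact h.mean_zero.le
  · exact (h.mean_lt r ⟨hr0, hr.2⟩).le

lemma tanPressure_pos (hlam : 0 < lam) (hmu : 0 < lam + mu) (hc : δc < criticalDensity lam mu)
    (h : IsBallProfile lam mu κ δc R δ η) (hr : r ∈ Ico 0 R) :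
    0 < tanPressure lam mu (δ r) (η r) := by
  have hr' := Ico_subset_Icc_self hr
  exact (h.pressure_pos r hr).trans_le <|
    radPressure_le_tanPressure (h.density_pos r hr') (h.density_le_mean hr')
      (shearProfile_pos hlam hmu (h.mean_pos hr') ((h.mean_le hr').trans_lt hc)).le

lemma contDiffOn_ballField (h : IsBallProfile lam mu κ δc R δ η)
    (hQ : ∀ q : ℝ × ℝ, 0 < q.1 → 0 < q.2 → ContDiffAt ℝ 1 (fun q : ℝ × ℝ => Q q.1 q.2) q) :
    ContDiffOn ℝ 1 (ballField R δ η Q) (Icc 0 R) := by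
  have hcomp : ContDiffOn ℝ 1 (fun r => Q (δ r) (η r)) (Icc 0 R) := fun r hr =>
    ContDiffAt.comp_contDiffWithinAt (f := fun r => (δ r, η r)) r
      (hQ (δ r, η r) (h.density_pos r hr) (h.mean_pos hr))
      ((h.contDiffOn_density r hr).prodMk (h.contDiffOn_mean r hr))
  exact hcomp.congr fun r hr => ballField_of_le hr.2

lemma derivWithin_ballField_zero (h : IsBallProfile lam mu κ δc R δ η)
    (hQ : ∀ q : ℝ × ℝ, 0 < q.1 → 0 < q.2 → ContDiffAt ℝ 1 (fun q : ℝ × ℝ => Q q.1 q.2) q) :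
    derivWithin (ballField R δ η Q) (Icc 0 R) 0 = 0 := by
  have hR := h.radius_pos
  have h0 : (0 : ℝ) ∈ Icc 0 R := ⟨le_rfl, hR.le⟩
  have hq := ((hQ (δ 0, η 0) (h.density_pos 0 h0) (h.mean_pos h0)).differentiableAt
    one_ne_zero).hasFDerivAt
  have hcomp := hq.comp_hasDerivAt (0 : ℝ) (h.hasDerivAt_density_zero.prodMk h.hasDerivAt_mean_zero)
  rw [Prod.mk_zero_zero, map_zero] at hcomp
  exact (hcomp.hasDerivWithinAt.congr (fun r hr => ballField_of_le hr.2)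
    (ballField_of_le hR.le)).derivWithin (uniqueDiffOn_Icc hR 0 h0)

lemma tendsto_deriv_ballField (h : IsBallProfile lam mu κ δc R δ η)
    (hQ : ∀ q : ℝ × ℝ, 0 < q.1 → 0 < q.2 → ContDiffAt ℝ 1 (fun q : ℝ × ℝ => Q q.1 q.2) q) :
    Tendsto (deriv (ballField R δ η Q)) (𝓝[>] 0) (𝓝 0) := by
  have hR := h.radius_pos
  have hlim := tendsto_nhdsGT_of_continuousOn hR
    ((contDiffOn_one_iff_derivWithin (uniqueDiffOn_Icc hR)).1 (h.contDiffOn_ballField hQ)).2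
  rw [h.derivWithin_ballField_zero hQ] at hlim
  refine hlim.congr' ?_
  filter_upwards [Ioo_mem_nhdsGT hR] with r hr
  exact derivWithin_of_mem_nhds (Icc_mem_nhds hr.1 hr.2)

lemma contDiffOn_ballDensity (h : IsBallProfile lam mu κ δc R δ η) :
    ContDiffOn ℝ 1 (ballDensity K R δ η) (Icc 0 R) :=
  h.contDiffOn_ballField fun _ _ _ => contDiffAt_const.mul contDiffAt_fst

lemma ballDensity_pos (h : IsBallProfile lam mu κ δc R δ η) (hK : 0 < K) (hr : r ∈ Icc 0 R) :
    0 < ballDensity K R δ η r := by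
  rw [ballDensity_of_le hr.2]
  exact mul_pos hK (h.density_pos r hr)

lemma setOf_ballDensity_pos (h : IsBallProfile lam mu κ δc R δ η) (hK : 0 < K) :
    {r : ℝ | 0 < r ∧ 0 < ballDensity K R δ η r} = Ioc 0 R := by
  ext r
  refine ⟨fun hr => ⟨hr.1, ?_⟩, fun hr => ⟨hr.1, h.ballDensity_pos hK (Ioc_subset_Icc_self hr)⟩⟩
  by_contra! hlt
  exact hr.2.ne' (ballField_of_lt hlt)

/-- `r³ η` is a primitive of `3 r² δ`. -/
lemma enclosedMass_ballDensity (h : IsBallProfile lam mu κ δc R δ η) (hr : r ∈ Icc 0 R) :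
    enclosedMass (ballDensity K R δ η) r = 4 * Real.pi / 3 * (K * η r) * r ^ 3 := by
  have hsub : Icc 0 r ⊆ Icc 0 R := Icc_subset_Icc_right hr.2
  have hη := h.contDiffOn_mean.continuousOn.mono hsub
  have hρ := (h.contDiffOn_ballDensity (K := K)).continuousOn.mono hsub
  have hprimitive (s) (hs : s ∈ Ioo 0 r) : HasDerivAt (fun s => K / 3 * (s ^ 3 * η s))
      (ballDensity K R δ η s * s ^ 2) s := by
    have hsR : s ∈ Ioo 0 R := ⟨hs.1, hs.2.trans_le hr.2⟩
    have := hs.1.ne'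
    refine (((hasDerivAt_pow 3 s).mul (h.hasDerivAt_mean s hsR)).const_mul
      (K / 3)).congr_deriv ?_
    rw [ballDensity_of_le hsR.2.le]
    push_cast
    field_simp
    ring
  rw [enclosedMass, intervalIntegral.integral_eq_sub_of_hasDerivAt_of_le hr.1
    (by fun_prop) hprimitive
    (ContinuousOn.intervalIntegrable_of_Icc hr.1 (by fun_prop))]
  ring

lemma meanRelDensity_ballDensity (h : IsBallProfile lam mu κ δc R δ η) (hK : K ≠ 0)
    (hr : r ∈ Ioc 0 R) : meanRelDensity K (ballDensity K R δ η) r = η r := by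
  have := hr.1.ne'
  have := Real.pi_pos.ne'
  rw [meanRelDensity, h.enclosedMass_ballDensity (Ioc_subset_Icc_self hr)]
  field_simp

lemma hasElasticPressures (h : IsBallProfile lam mu κ δc R δ η) (hK : 0 < K) :
    HasElasticPressures K (hadamardRad lam mu) (hadamardTan lam mu) (ballDensity K R δ η)
      (ballField R δ η (radPressure lam mu)) (ballField R δ η (tanPressure lam mu)) where
  refDensity_pos := hK
  contDiff_rad := contDiffOn_hadamardRad
  contDiff_tan := contDiffOn_hadamardTan
  rad_eq r hr hρ := by
    have hrR : r ∈ Ioc 0 R := h.setOf_ballDensity_pos hK ▸ ⟨hr, hρ⟩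
    have hr' := Ioc_subset_Icc_self hrR
    rw [relDensity_ballDensity hK.ne' hrR.2, h.meanRelDensity_ballDensity hK.ne' hrR,
      ballField_of_le hrR.2, hadamardRad_eq (h.density_pos r hr') (h.mean_pos hr')]
  tan_eq r hr hρ := by
    have hrR : r ∈ Ioc 0 R := h.setOf_ballDensity_pos hK ▸ ⟨hr, hρ⟩
    have hr' := Ioc_subset_Icc_self hrR
    rw [relDensity_ballDensity hK.ne' hrR.2, h.meanRelDensity_ballDensity hK.ne' hrR,
      ballField_of_le hrR.2, hadamardTan_eq (h.density_pos r hr') (h.mean_pos hr')]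

lemma hasDerivAt_ballField_radPressure (hlam : 0 < lam) (hmu : 0 < lam + mu) (hK : K ≠ 0)
    (hc : δc < criticalDensity lam mu)
    (h : IsBallProfile lam mu (4 * Real.pi / 3 * K ^ 2) δc R δ η) (hr : r ∈ Ioo 0 R) :
    HasDerivAt (ballField R δ η (radPressure lam mu))
      (-(2 / r) * (ballField R δ η (radPressure lam mu) r
          - ballField R δ η (tanPressure lam mu) r)
        - ballDensity K R δ η r * (enclosedMass (ballDensity K R δ η) r / r ^ 2)) r := by
  have hr' := Ioo_subset_Icc_self hr
  have hδ := h.density_pos r hr'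
  have hη := h.mean_pos hr'
  have hchain := hasDerivAt_radPressure_comp (lam := lam) (mu := mu) hr.1.ne' hδ hη
    (h.hasDerivAt_density r hr) (h.hasDerivAt_mean r hr)
  rw [(equilibrium_iff hr.1 hδ hη
    (radProfile_pos hlam hmu hη ((h.mean_le hr').trans_lt hc))).2 rfl] at hchain
  rw [mul_enclosedMass_div_sq hK hr.1.ne', relDensity_ballDensity hK hr.2.le,
    h.meanRelDensity_ballDensity hK (Ioo_subset_Ioc_self hr), ballField_of_le hr.2.le,
    ballField_of_le hr.2.le]
  exact hchain.congr_of_eventuallyEq <|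
    eventually_of_mem (Ioo_mem_nhds hr.1 hr.2) fun s hs => ballField_of_le hs.2.le

theorem isStronglyRegularBall (hlam : 0 < lam) (hmu : 0 < lam + mu) (hK : 0 < K)
    (hc : δc < criticalDensity lam mu)
    (h : IsBallProfile lam mu (4 * Real.pi / 3 * K ^ 2) δc R δ η) :
    IsStronglyRegularBall (ballDensity K R δ η) (ballField R δ η (radPressure lam mu))
      (ballField R δ η (tanPressure lam mu)) R := by
  have hρ := h.contDiffOn_ballDensity (K := K)
  have hrad := h.contDiffOn_ballField fun _ => contDiffAt_radPressure (lam := lam) (mu := mu)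
  have htan := h.contDiffOn_ballField fun _ => contDiffAt_tanPressure (lam := lam) (mu := mu)
  exact {
    radius_pos := h.radius_pos
    support := by rw [h.setOf_ballDensity_pos hK, interior_Ioc]
    cont_rho := hρ.continuousOn
    cont_prad := hrad.continuousOn
    cont_ptan := htan.continuousOn
    contDiff_rho := hρ.mono Ioc_subset_Icc_self
    contDiff_prad := hrad.mono Ioc_subset_Icc_self
    contDiff_ptan := htan.mono Ioc_subset_Icc_self
    equilibrium := fun _ hr => h.hasDerivAt_ballField_radPressure hlam hmu hK.ne' hc hr
    prad_pos := fun r hr => by rw [ballField_of_le hr.2.le]; exact h.pressure_pos r hr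
    ptan_pos := fun r hr => by rw [ballField_of_le hr.2.le]; exact h.tanPressure_pos hlam hmu hc hr
    prad_boundary := by rw [ballField_of_le le_rfl, h.pressure_boundary]
    isotropic_center := by
      rw [ballField_of_le h.radius_pos.le, ballField_of_le h.radius_pos.le, h.density_zero,
        h.mean_zero, tanPressure_self]
    rho_vacuum := fun _ => ballField_of_lt
    prad_vacuum := fun _ => ballField_of_lt
    ptan_vacuum := fun _ => ballField_of_lt
    contDiff_rho_center := hρ
    contDiff_prad_center := hrad
    contDiff_ptan_center := htan
    deriv_rho_center := h.tendsto_deriv_ballField fun _ _ _ => contDiffAt_const.mul contDiffAt_fst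
    deriv_prad_center := h.tendsto_deriv_ballField fun _ => contDiffAt_radPressure
    deriv_ptan_center := h.tendsto_deriv_ballField fun _ => contDiffAt_tanPressure }

lemma deriv_hadamardRad_pos (hlam : 0 < lam) (hmu : 0 < lam + mu)
    (hc : δc < criticalDensity lam mu) (h : IsBallProfile lam mu κ δc R δ η) (hK : K ≠ 0)
    (hr : r ∈ Ioc 0 R) :
    0 < deriv (fun d => hadamardRad lam mu d (meanRelDensity K (ballDensity K R δ η) r))
      (relDensity K (ballDensity K R δ η) r) := by
  have hr' := Ioc_subset_Icc_self hr
  have hη := h.mean_pos hr'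
  rw [h.meanRelDensity_ballDensity hK hr, relDensity_ballDensity hK hr.2,
    deriv_hadamardRad_fst (h.density_pos r hr') hη]
  exact div_pos (radProfile_pos hlam hmu hη ((h.mean_le hr').trans_lt hc))
    (pow_pos (h.density_pos r hr') 2)

lemma ballDensity_lt_central (h : IsBallProfile lam mu κ δc R δ η) (hK : 0 < K)
    (hr : r ∈ Ioc 0 R) : ballDensity K R δ η r < K * δc := by
  rw [ballDensity_of_le hr.2]
  exact mul_lt_mul_of_pos_left ((h.density_lt_mean r hr).trans (h.mean_lt r hr)) hK

lemma lt_enclosedMass_ballDensity (hlam : 0 < lam) (hmu : 0 < lam + mu)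
    (hc : δc < criticalDensity lam mu) (h : IsBallProfile lam mu κ δc R δ η) (hK : 0 < K)
    (hr : r ∈ Ioc 0 R) :
    4 * Real.pi / 3 * max (ballDensity K R δ η r) K * r ^ 3 <
      enclosedMass (ballDensity K R δ η) r := by
  have hmax : max (ballDensity K R δ η r) K < K * η r := by
    rw [ballDensity_of_le hr.2]
    exact max_lt (mul_lt_mul_of_pos_left (h.density_lt_mean r hr) hK)
      (lt_mul_of_one_lt_right hK (h.one_lt_mean hlam hmu hc hr))
  have := pow_pos hr.1 3
  rw [h.enclosedMass_ballDensity (Ioc_subset_Icc_self hr)]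
  gcongr

lemma enclosedMass_ballDensity_lt (h : IsBallProfile lam mu κ δc R δ η) (hK : 0 < K)
    (hr : r ∈ Ioc 0 R) :
    enclosedMass (ballDensity K R δ η) r < 4 * Real.pi / 3 * (K * δc) * r ^ 3 := by
  have := pow_pos hr.1 3
  have := h.mean_lt r hr
  rw [h.enclosedMass_ballDensity (Ioc_subset_Icc_self hr)]
  gcongr

end IsBallProfile

end BallField

end

theorem theorem6_general (lam mu : ℝ) (hlam : 0 < lam) (hmu : 0 < lam + mu) :
    (∀ (K R : ℝ) (ρ prad ptan : ℝ → ℝ),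
      IsRegularElasticBall K (hadamardRad lam mu) (hadamardTan lam mu) ρ prad ptan R →
        1 < ρ 0 / K) ∧
    (∀ K ρc : ℝ, 0 < K → 1 < ρc / K → ρc / K < ((lam + mu) / lam) ^ (3 / 2 : ℝ) →
      0 < deriv (fun d => hadamardRad lam mu d (ρc / K)) (ρc / K) ∧
      ∃ (ρ prad ptan : ℝ → ℝ) (R : ℝ),
        IsStronglyRegularElasticBall K (hadamardRad lam mu) (hadamardTan lam mu)
          ρ prad ptan R ∧
        ρ 0 = ρc ∧
        (∀ r ∈ Ioc 0 R,
          0 < ρ r ∧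
          0 < deriv (fun d => hadamardRad lam mu d (meanRelDensity K ρ r))
            (relDensity K ρ r) ∧
          ρ r < ρc ∧
          4 * Real.pi / 3 * max (ρ r) K * r ^ 3 < enclosedMass ρ r ∧
          enclosedMass ρ r < 4 * Real.pi / 3 * ρc * r ^ 3) ∧
        (∀ (ρ' prad' ptan' : ℝ → ℝ) (R' : ℝ),
          IsRegularElasticBall K (hadamardRad lam mu) (hadamardTan lam mu)
            ρ' prad' ptan' R' →
          ρ' 0 = ρc →
            R' = R ∧ EqOn ρ' ρ (Ici 0) ∧ EqOn prad' prad (Ici 0) ∧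
              EqOn ptan' ptan (Ici 0))) := by
  refine ⟨fun K R ρ prad ptan h => IsHadamardBall.one_lt_central hlam hmu h,
    fun K ρc hK h1 hcrit => ?_⟩
  change ρc / K < criticalDensity lam mu at hcrit
  have hmu' : 0 < mu := (one_lt_criticalDensity_iff hlam hmu).1 (h1.trans hcrit)
  have hδc : 0 < ρc / K := one_pos.trans h1
  have hKδ : K * (ρc / K) = ρc := mul_div_cancel₀ ρc hK.ne'
  obtain ⟨R, δ, η, h⟩ := exists_isBallProfile hlam hmu'
    (by positivity : 0 < 4 * Real.pi / 3 * K ^ 2) h1 hcrit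
  have hball := h.isStronglyRegularBall hlam hmu hK hcrit
  have helastic := h.hasElasticPressures hK
  have hρ0 : ballDensity K R δ η 0 = ρc := by
    rw [ballDensity_of_le h.radius_pos.le, h.density_zero, hKδ]
  refine ⟨?_, _, _, _, R, ⟨hball, helastic⟩, hρ0, fun r hr => ⟨?_, ?_, ?_, ?_, ?_⟩,
    fun ρ' prad' ptan' R' h' h0 => ?_⟩
  · rw [deriv_hadamardRad_fst hδc hδc]
    exact div_pos (radProfile_pos hlam hmu hδc hcrit) (pow_pos hδc 2)
  · exact h.ballDensity_pos hK (Ioc_subset_Icc_self hr)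
  · exact h.deriv_hadamardRad_pos hlam hmu hcrit hK.ne' hr
  · exact (h.ballDensity_lt_central hK hr).trans_eq hKδ
  · exact h.lt_enclosedMass_ballDensity hlam hmu hcrit hK hr
  · exact hKδ ▸ h.enclosedMass_ballDensity_lt hK hr
  · exact IsHadamardBall.unique hlam hmu h' ⟨hball.toIsRegularBall, helastic⟩
      (h0.trans hρ0.symm) (by rwa [hρ0])

theorem theorem6 (lam mu : ℝ) (hlam : 0 < lam) (hmu : 0 ≤ mu) :
    (∀ (K R : ℝ) (ρ prad ptan : ℝ → ℝ),
      IsRegularElasticBall K (hadamardRad lam mu) (hadamardTan lam mu) ρ prad ptan R →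
        1 < ρ 0 / K) ∧
    (∀ K ρc : ℝ, 0 < K → 1 < ρc / K → ρc / K < ((lam + mu) / lam) ^ (3 / 2 : ℝ) →
      0 < deriv (fun d => hadamardRad lam mu d (ρc / K)) (ρc / K) ∧
      ∃ (ρ prad ptan : ℝ → ℝ) (R : ℝ),
        IsStronglyRegularElasticBall K (hadamardRad lam mu) (hadamardTan lam mu)
          ρ prad ptan R ∧
        ρ 0 = ρc ∧
        (∀ r ∈ Ioc 0 R,
          0 < ρ r ∧
          0 < deriv (fun d => hadamardRad lam mu d (meanRelDensity K ρ r))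
            (relDensity K ρ r) ∧
          ρ r < ρc ∧
          4 * Real.pi / 3 * max (ρ r) K * r ^ 3 < enclosedMass ρ r ∧
          enclosedMass ρ r < 4 * Real.pi / 3 * ρc * r ^ 3) ∧
        (∀ (ρ' prad' ptan' : ℝ → ℝ) (R' : ℝ),
          IsRegularElasticBall K (hadamardRad lam mu) (hadamardTan lam mu)
            ρ' prad' ptan' R' →
          ρ' 0 = ρc →
            R' = R ∧ EqOn ρ' ρ (Ici 0) ∧ EqOn prad' prad (Ici 0) ∧
              EqOn ptan' ptan (Ici 0))) :=
  theorem6_general lam mu hlam (add_pos_of_pos_of_nonneg hlam hmu)
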